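/- **Theorem (Termination of OciorABA).** Let $n\ge 3t+1$. Consider $n$ nodes in an asynchronous network with authenticated channels (messages between honest nodes are delayed arbitrarily but eventually arrive). At most $t$ nodes are ever dishonest and behave arbitrarily. Every honest node $i$ eventually receives an input message $\boldsymbol w_i\in\Sigma^{t+1}$ and runs the protocol OciorABA below. Then, in every execution in which the elections of the $n$ rounds of APVA select at least $2t+1$ different nodes (in particular, whenever no node is elected twice), every honest node eventually outputs a message (possibly the default value $\bot$) and terminates. *Primitives.* An $(n,t+1)$ erasure code over $\Sigma$ (any $t+1$ symbols of a codeword determine the message); and instances of * reliable broadcast (RBC) with a leader. Consistency: honest nodes do not output different values. Validity: if the leader is honest and inputs $v$, every honest node eventually outputs $v$. Totality: if one honest node outputs a value, every honest node eventually does. An honest leader's instance delivers nothing before the leader's input; * binary Byzantine agreement (ABBA). Termination: if all honest nodes give inputs, every honest node eventually outputs. Consistency: if one honest node outputs $v$, every honest node eventually outputs $v$. Validity: if all honest nodes input $v$, every honest node eventually outputs $v$; * common coin elections, one per round. All outputs of an election at honest nodes are the same node index $l\in[1:n]$, and if $t+1$ honest nodes activate the election, every honest node that activates it gets an output. An instance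 outputs at most once at each node. Clauses "upon $\dots$" are executed once per instance of their condition, after an arbitrary finite delay if the condition stays satisfied; "send" means to all nodes; "$k$ messages" means from $k$ distinct nodes. *OciorABA at node $i$.* Upon input $\boldsymbol w_i$: encode it into $(y^{(i)}_1,\dots,y^{(i)}_n)$ and input $y^{(i)}_i$ into $\mathrm{RBC}[ID,i]$ (leader $i$). Upon delivery of $y_j$ from $\mathrm{RBC}[ID,j]$ and once $y^{(i)}_j$ is known: pass to APVA, as the $j$th entry, the bit $1$ if $y_j=y^{(i)}_j$ and $0$ otherwise. Upon output $\boldsymbol v\in\{0,1,\text{missing}\}^n$ of APVA: let $B=\{j:\boldsymbol v[j]=1\}$. If $|B|<t+1$, output $\bot$ and terminate. Otherwise wait until $y_j$ is delivered from $\mathrm{RBC}[ID,j]$ for the $t+1$ smallest $j\in B$, decode these symbols, output the result and terminate. *APVA at node $i$.* Pass the input bits to ACID (below). If ACID delivers a vector $C_i$, input it into $\mathrm{RBC}[ID',i]$ (leader $i$); pass each vector $C_j$ delivered by $\mathrm{RBC}[ID',j]$ to ACID. When ACID has returned bits $R^{(b)}[j],F^{(b)}[j],R'[j],F'[j]$,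 run rounds $r=1,\dots,n$: 1. activate election $r$ and obtain $l$; 2. run $\mathrm{ABBBA}[ID',l,0]$ with input $(R'[l],F'[l])$, and give its output to $\mathrm{ABBA}[ID',l]$ as input; if that outputs $0$, end the round; 3. otherwise wait for the vector $C_l$ from $\mathrm{RBC}[ID',l]$; let $M$ be the set of its non-missing positions; if $|M|<n-t$, end the round; 4. otherwise run $\mathrm{ABBBA}[ID,l,j]$ with input $(R^{(C_l[j])}[j],F^{(C_l[j])}[j])$ for all $j\in M$; give to $\mathrm{ABBA}[ID,l]$ the input $1$ if all of them output $1$, and $0$ otherwise; if it outputs $1$, output $C_l$ and stop; otherwise end the round. If a node $l$ is elected again, its instances are not invoked again; their outputs are reused. After round $n$ without output, APVA does nothing more. *ACID at node $i$.* All bits are initially $0$, $C_i$ is initially all missing. * Upon input bit $b$ for position $j$: send $\mathrm{VOTE}(j,b)$. * Upon $t+1$ messages $\mathrm{VOTE}(j,b)$: send $\mathrm{VOTE}(j,b)$ if not yet sent, set $R^{(b)}[j]=1$, send $\mathrm{READY}(j,b)$. * Upon $n-t$ messages $\mathrm{READY}(j,b)$: set $F^{(b)}[j]=1$, send $\mathrm{FINISH}(j,b)$.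 * Upon $n-t$ messages $\mathrm{FINISH}(j,b)$: if $C_i[j]$ is missing, set $C_i[j]=b$. As soon as $n-t$ entries of $C_i$ are set, deliver $C_i$ to APVA. * Upon a vector $C_j$ from APVA: set $R'[j]=1$, send $\mathrm{READY}'(j)$. * Upon $n-t$ messages $\mathrm{READY}'(j)$: set $F'[j]=1$, send $\mathrm{FINISH}'(j)$. * Upon $n-t$ messages $\mathrm{FINISH}'(i)$: send $\mathrm{ELECTION}$. * Upon $n-t$ messages $\mathrm{ELECTION}$ or $t+1$ messages $\mathrm{CONFIRM}$: send $\mathrm{CONFIRM}$ if not yet sent. * Upon $2t+1$ messages $\mathrm{CONFIRM}$: send $\mathrm{CONFIRM}$ if not yet sent, return all the bits $R^{(b)}[j],F^{(b)}[j],R'[j],F'[j]$ and stop ACID. *An ABBBA instance.* Upon input $(a_1,a_2)\in\{0,1\}^2$: send $\mathrm{VALUE}(a_1,a_2)$, and if $a_1=1$ or $a_2=1$, output $1$ and stop. Otherwise, counting the first $\mathrm{VALUE}$ message of each node (including those received before the own input), wait until $t+1$ of them have $a_1=1$, or $t+1$ have $a_2=1$, or $n-t$ have $a_2=0$; output $1$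 in the first two cases and $0$ in the third alone. -/

import Mathlib

namespace OciorABA

/-! ## Basic objects -/

/-- A partial binary vector of length `n`; `none` is a missing entry. -/
abbrev PVec (n : ℕ) := Fin n → Option Bool

/-- The set of indices of the non-missing entries. -/
def nonMissing {n : ℕ} (v : PVec n) : Finset (Fin n) :=
  Finset.univ.filter fun j => (v j).isSome

/-- The `k` smallest elements of `B` (all of `B` if it has fewer than `k` elements). -/
def smallest {n : ℕ} (k : ℕ) (B : Finset (Fin n)) : Finset (Fin n) :=
  B.filter fun j => (B.filter fun j' => j' < j).card < k

/-- An `(n, k)` erasure code over the alphabet `A`: every message is recovered from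
any `k` of its `n` encoded symbols. -/
structure ErasureCode (n k : ℕ) (A : Type*) where
  /-- encoding -/
  enc : (Fin k → A) → Fin n → A
  /-- decoding from the symbols at the positions in `J` -/
  dec : (J : Finset (Fin n)) → (J → A) → Fin k → A
  dec_enc : ∀ (w : Fin k → A) (J : Finset (Fin n)), J.card = k →
    dec J (fun j => enc w j) = w

/-- Identities of the instances of biased binary agreement: `main l` is `(ID', l, 0)` and
`entry l j` is `(ID, l, j)`. -/
inductive BiasedId (n : ℕ)
  | main (l : Fin n)
  | entry (l j : Fin n)

/-- Identities of the instances of binary agreement: `first l` is `(ID', l)` and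
`second l` is `(ID, l)`. -/
inductive AgreeId (n : ℕ)
  | first (l : Fin n)
  | second (l : Fin n)

/-- The messages that the nodes exchange. `ready j b`, `finish j b` carry the identity `ID`,
`readyRbc j`, `finishRbc j` the identity `ID'`; `value k a₁ a₂` is the message of the biased
agreement instance `k`. -/
inductive Msg (n : ℕ)
  | vote (j : Fin n) (b : Bool)
  | ready (j : Fin n) (b : Bool)
  | finish (j : Fin n) (b : Bool)
  | readyRbc (j : Fin n)
  | finishRbc (j : Fin n)
  | election
  | confirm
  | value (k : BiasedId n) (a₁ a₂ : Bool)

/-- Control point of the main thread of vector agreement. The argument `r` is the round, `l` the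
elected node and `v` the vector received from the reliable broadcast of `l`. -/
inductive Pc (n : ℕ)
  /-- the dispersal has not been evaluated yet -/
  | idle
  /-- waiting for the election of round `r` -/
  | electing (r : Fin n)
  /-- waiting for the biased agreement `(ID', l, 0)` -/
  | biased (r l : Fin n)
  /-- waiting for the agreement `(ID', l)` -/
  | agree (r l : Fin n)
  /-- waiting for the vector broadcast by `l` -/
  | waitVec (r l : Fin n)
  /-- waiting for the biased agreements `(ID, l, j)`, `j` a non-missing position of `v` -/
  | entries (r l : Fin n) (v : PVec n)
  /-- waiting for the agreement `(ID, l)` -/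
  | agreeVec (r l : Fin n) (v : PVec n)
  /-- all rounds are over, and no vector was output -/
  | exhausted
  /-- vector agreement has output `v` and terminated -/
  | done (v : PVec n)

/-- The local state of a node. -/
structure NodeState (n t : ℕ) (A : Type*) where
  /-- the encoded symbols of the own message, once the input has been received -/
  syms : Option (Fin n → A)
  /-- the input passed to vector agreement so far -/
  apvaIn : PVec n
  /-- the output; the inner `none` is the default value -/
  output : Option (Option (Fin (t + 1) → A))
  /-- whether the node has terminated -/
  terminated : Bool
  /-- the messages sent so far (each is sent to all nodes) -/
  sent : Set (Msg n)
  /-- the messages received so far, with their senders -/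
  rcvd : Set (Fin n × Msg n)
  /-- the own input to the reliable broadcast of symbols led by this node -/
  symIn : Option A
  /-- the outputs of the reliable broadcasts of symbols, by leader -/
  symOut : Fin n → Option A
  /-- the own input to the reliable broadcast of vectors led by this node -/
  vecIn : Option (PVec n)
  /-- the outputs of the reliable broadcasts of vectors, by leader -/
  vecOut : Fin n → Option (PVec n)
  /-- the own inputs to the binary agreements -/
  agreeIn : AgreeId n → Option Bool
  /-- the outputs of the binary agreements -/
  agreeOut : AgreeId n → Option Bool
  /-- the rounds whose election this node has activated -/
  coinOn : Set (Fin n)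
  /-- the outputs of the elections -/
  coinOut : Fin n → Option (Fin n)
  /-- ready indicators, by value and position -/
  R : Bool → Fin n → Bool
  /-- finish indicators, by value and position -/
  F : Bool → Fin n → Bool
  /-- ready indicators of the broadcasts of vectors -/
  rbcR : Fin n → Bool
  /-- finish indicators of the broadcasts of vectors -/
  rbcF : Fin n → Bool
  /-- the vector of confirmed values -/
  C : PVec n
  /-- the number of confirmed values -/
  cnt : ℕ
  /-- whether the dispersal protocol has returned (and stopped) -/
  returned : Bool
  /-- the own inputs to the biased agreements -/
  biasedIn : BiasedId n → Option (Bool × Bool)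
  /-- the own outputs of the biased agreements -/
  biasedOut : BiasedId n → Option Bool
  /-- the control point of vector agreement -/
  pc : Pc n

/-- The initial local state. -/
def NodeState.init (n t : ℕ) (A : Type*) : NodeState n t A where
  syms := none
  apvaIn := fun _ => none
  output := none
  terminated := false
  sent := ∅
  rcvd := ∅
  symIn := none
  symOut := fun _ => none
  vecIn := none
  vecOut := fun _ => none
  agreeIn := fun _ => none
  agreeOut := fun _ => none
  coinOn := ∅
  coinOut := fun _ => none
  R := fun _ _ => false
  F := fun _ _ => false
  rbcR := fun _ => false
  rbcF := fun _ => false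
  C := fun _ => none
  cnt := 0
  returned := false
  biasedIn := fun _ => none
  biasedOut := fun _ => none
  pc := .idle

/-! ## The code of a node -/

section Code

variable {n t : ℕ} {A : Type*}

open Classical in
/-- The number of distinct nodes from which the message `m` has been received. -/
noncomputable def NodeState.count (s : NodeState n t A) (m : Msg n) : ℕ :=
  (Finset.univ.filter fun p => (p, m) ∈ s.rcvd).card

open Classical in
/-- The number of nodes whose value message in the biased agreement `k` has first entry `1`. -/
noncomputable def NodeState.cntFst (s : NodeState n t A) (k : BiasedId n) : ℕ :=
  (Finset.univ.filter fun p => ∃ a₂, (p, Msg.value k true a₂) ∈ s.rcvd).card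

open Classical in
/-- The number of nodes whose value message in the biased agreement `k` has second entry `1`. -/
noncomputable def NodeState.cntSnd (s : NodeState n t A) (k : BiasedId n) : ℕ :=
  (Finset.univ.filter fun p => ∃ a₁, (p, Msg.value k a₁ true) ∈ s.rcvd).card

open Classical in
/-- The number of nodes whose value message in the biased agreement `k` has second entry `0`. -/
noncomputable def NodeState.cntZero (s : NodeState n t A) (k : BiasedId n) : ℕ :=
  (Finset.univ.filter fun p => ∃ a₁, (p, Msg.value k a₁ false) ∈ s.rcvd).card

/-- Sending a set of messages to all nodes. -/
def NodeState.send (s : NodeState n t A) (M : Set (Msg n)) : NodeState n t A :=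
  { s with sent := s.sent ∪ M }

open Classical in
/-- Receiving the message `m` from `p`; in a biased agreement only the first value message of
each node is taken into account. -/
noncomputable def NodeState.receive (s : NodeState n t A) (p : Fin n) (m : Msg n) :
    NodeState n t A :=
  match m with
  | .value k _ _ =>
    if ∃ b₁ b₂, (p, Msg.value k b₁ b₂) ∈ s.rcvd then s
    else { s with rcvd := insert (p, m) s.rcvd }
  | _ => { s with rcvd := insert (p, m) s.rcvd }

/-- Giving inputs to biased agreements: every instance `k` with `inp k = some (a₁, a₂)` that this
node has not invoked before is invoked with the input `(a₁, a₂)`: the node sends its value message,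
and it outputs `1` at once if `a₁ = 1` or `a₂ = 1`. -/
def NodeState.callBiased (s : NodeState n t A) (inp : BiasedId n → Option (Bool × Bool)) :
    NodeState n t A :=
  let new : BiasedId n → Option (Bool × Bool) :=
    fun k => if (s.biasedIn k).isSome then none else inp k
  { s with
    biasedIn := fun k => (s.biasedIn k).or (new k)
    sent := s.sent ∪ {m | ∃ k a₁ a₂, new k = some (a₁, a₂) ∧ m = .value k a₁ a₂}
    biasedOut := fun k => if new k = some (true, true) ∨ new k = some (true, false) ∨
      new k = some (false, true) then some true else s.biasedOut k }

open Classical in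
/-- Giving the input `b` to the binary agreement `k`, unless the node gave an input before. -/
noncomputable def NodeState.callAgree (s : NodeState n t A) (k : AgreeId n) (b : Bool) :
    NodeState n t A :=
  { s with agreeIn := Function.update s.agreeIn k ((s.agreeIn k).or (some b)) }

/-- Beginning round `r`: the node activates the election of that round. -/
def NodeState.beginRound (s : NodeState n t A) (r : Fin n) : NodeState n t A :=
  { s with pc := .electing r, coinOn := insert r s.coinOn }

/-- Going on to the round after `r`, if there is one. -/
def NodeState.nextRound (s : NodeState n t A) (r : Fin n) : NodeState n t A :=
  if h : r.val + 1 < n then s.beginRound ⟨r.val + 1, h⟩ else { s with pc := .exhausted }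

open Classical in
/-- One step of the main thread of vector agreement at node `i`; `none` if the thread has to wait.
The indicators `R`, `F`, `rbcR`, `rbcF` are those that the dispersal protocol has
returned: it has stopped, and they do not change any more. -/
noncomputable def apvaStep (i : Fin n) (s : NodeState n t A) : Option (NodeState n t A) :=
  match s.pc with
  | .idle => if s.returned then some (s.beginRound ⟨0, i.pos⟩) else none
  | .electing r =>
    match s.coinOut r with
    | none => none
    | some l =>
      some { s.callBiased (fun k => if k = .main l then some (s.rbcR l, s.rbcF l) else none) with
        pc := .biased r l }
  | .biased r l =>
    match s.biasedOut (.main l) with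
    | none => none
    | some a => some { s.callAgree (.first l) a with pc := .agree r l }
  | .agree r l =>
    match s.agreeOut (.first l) with
    | none => none
    | some true => some { s with pc := .waitVec r l }
    | some false => some (s.nextRound r)
  | .waitVec r l =>
    match s.vecOut l with
    | none => none
    | some v =>
      if n - t ≤ (nonMissing v).card then
        some { s.callBiased (fun k =>
            match k with
            | .main _ => none
            | .entry l' j => if l' = l then (v j).map fun b => (s.R b j, s.F b j) else none) with
          pc := .entries r l v }
      else some (s.nextRound r)
  | .entries r l v =>
    if ∀ j ∈ nonMissing v, (s.biasedOut (.entry l j)).isSome then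
      some { s.callAgree (.second l)
          (decide (∀ j ∈ nonMissing v, s.biasedOut (.entry l j) = some true)) with
        pc := .agreeVec r l v }
    else none
  | .agreeVec r l v =>
    match s.agreeOut (.second l) with
    | none => none
    | some true => some { s with pc := .done v }
    | some false => some (s.nextRound r)
  | .exhausted => none
  | .done _ => none

open Classical in
/-- The last part of the agreement protocol: once vector agreement has output `v`, the node either
outputs the default value, or waits for the symbols at the `t + 1` smallest positions where
`v` is `1` and outputs the decoded message. In both cases it terminates. -/
noncomputable def decideStep (ec : ErasureCode n (t + 1) A) (s : NodeState n t A) :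
    Option (NodeState n t A) :=
  match s.pc with
  | .done v =>
    let B : Finset (Fin n) := Finset.univ.filter fun j => v j = some true
    if B.card < t + 1 then some { s with output := some none, terminated := true }
    else
      if h : ∀ j ∈ smallest (t + 1) B, (s.symOut j).isSome then
        some { s with
          output := some (some (ec.dec (smallest (t + 1) B)
            fun j => (s.symOut j.1).get (h j.1 j.2)))
          terminated := true }
      else none
  | _ => none

/-- The local actions of a node, one for each clause of the code. -/
inductive Rule (n : ℕ)
  /-- pass the comparison of the received and the own `j`-th symbol to vector agreement -/
  | passInput (j : Fin n)
  | vote (j : Fin n) (b : Bool)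
  | ready (j : Fin n) (b : Bool)
  | finish (j : Fin n) (b : Bool)
  | confirm (j : Fin n) (b : Bool)
  | rbcReady (j : Fin n)
  | rbcFinish (j : Fin n)
  | election
  | confirmElection
  | confirmAmplify
  | acidReturn
  | biasedOut (k : BiasedId n)
  | apva
  | decide

open Classical in
/-- The effect of a local action at node `i`; `none` if the action is not enabled. A node that has
terminated takes no action, and a node whose dispersal protocol has returned takes no
action of that protocol any more. -/
noncomputable def fire (ec : ErasureCode n (t + 1) A) (i : Fin n) (ρ : Rule n)
    (s : NodeState n t A) : Option (NodeState n t A) :=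
  if s.terminated then none else
  match ρ with
  | .passInput j =>
    match s.symOut j, s.syms with
    | some y, some ys =>
      if s.apvaIn j = none then
        some { s with apvaIn := Function.update s.apvaIn j (some (decide (y = ys j))) }
      else none
    | _, _ => none
  | .vote j b =>
    if ¬ s.returned ∧ s.apvaIn j = some b ∧ Msg.vote j b ∉ s.sent then
      some (s.send {.vote j b})
    else none
  | .ready j b =>
    if ¬ s.returned ∧ t + 1 ≤ s.count (.vote j b) ∧ s.R b j = false then
      some { s.send {.vote j b, .ready j b} with
        R := Function.update s.R b (Function.update (s.R b) j true) }
    else none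
  | .finish j b =>
    if ¬ s.returned ∧ n - t ≤ s.count (.ready j b) ∧ s.F b j = false then
      some { s.send {.finish j b} with
        F := Function.update s.F b (Function.update (s.F b) j true) }
    else none
  | .confirm j b =>
    if ¬ s.returned ∧ n - t ≤ s.count (.finish j b) ∧ s.C j = none then
      let C' : PVec n := Function.update s.C j (some b)
      some { s with
        C := C'
        cnt := s.cnt + 1
        vecIn := if s.cnt + 1 = n - t then some C' else s.vecIn }
    else none
  | .rbcReady j =>
    if ¬ s.returned ∧ (s.vecOut j).isSome ∧ s.rbcR j = false then
      some { s.send {.readyRbc j} with rbcR := Function.update s.rbcR j true }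
    else none
  | .rbcFinish j =>
    if ¬ s.returned ∧ n - t ≤ s.count (.readyRbc j) ∧ s.rbcF j = false then
      some { s.send {.finishRbc j} with rbcF := Function.update s.rbcF j true }
    else none
  | .election =>
    if ¬ s.returned ∧ n - t ≤ s.count (.finishRbc i) ∧ Msg.election ∉ s.sent then
      some (s.send {.election})
    else none
  | .confirmElection =>
    if ¬ s.returned ∧ n - t ≤ s.count .election ∧ Msg.confirm ∉ s.sent then
      some (s.send {.confirm})
    else none
  | .confirmAmplify =>
    if ¬ s.returned ∧ t + 1 ≤ s.count .confirm ∧ Msg.confirm ∉ s.sent then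
      some (s.send {.confirm})
    else none
  | .acidReturn =>
    if ¬ s.returned ∧ 2 * t + 1 ≤ s.count .confirm then
      some { s.send {.confirm} with returned := true }
    else none
  | .biasedOut k =>
    if (s.biasedIn k).isSome ∧ s.biasedOut k = none then
      if t + 1 ≤ s.cntFst k ∨ t + 1 ≤ s.cntSnd k then
        some { s with biasedOut := Function.update s.biasedOut k (some true) }
      else if n - t ≤ s.cntZero k then
        some { s with biasedOut := Function.update s.biasedOut k (some false) }
      else none
    else none
  | .apva => apvaStep i s
  | .decide => decideStep ec s

/-- What can happen at a node: it receives its input, receives a message, obtains an output from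
a reliable broadcast, a binary agreement or an election, or takes a local action. -/
inductive Event (n : ℕ) (A : Type*)
  | input
  | receive (p : Fin n) (m : Msg n)
  | symOut (j : Fin n) (y : A)
  | vecOut (j : Fin n) (v : PVec n)
  | agreeOut (k : AgreeId n) (b : Bool)
  | coinOut (r l : Fin n)
  | act (ρ : Rule n)

open Classical in
/-- The effect of an event at node `i` with initial message `w`; `none` if it is not possible.
A primitive outputs at most once at a node: a further output is ignored. -/
noncomputable def Event.apply (ec : ErasureCode n (t + 1) A) (i : Fin n) (w : Fin (t + 1) → A)
    (s : NodeState n t A) : Event n A → Option (NodeState n t A)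
  | .input =>
    if s.terminated then some s
    else some { s with syms := some (ec.enc w), symIn := some (ec.enc w i) }
  | .receive p m => some (s.receive p m)
  | .symOut j y => some { s with symOut := Function.update s.symOut j ((s.symOut j).or (some y)) }
  | .vecOut j v => some { s with vecOut := Function.update s.vecOut j ((s.vecOut j).or (some v)) }
  | .agreeOut k b =>
    some { s with agreeOut := Function.update s.agreeOut k ((s.agreeOut k).or (some b)) }
  | .coinOut r l =>
    some { s with coinOut := Function.update s.coinOut r ((s.coinOut r).or (some l)) }
  | .act ρ => fire ec i ρ s

end Code

/-! ## The primitives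

An instance of a primitive is seen through the inputs it has been given and the outputs it has
made by each time `τ`; `H` is the set of honest nodes. -/

/-- Reliable broadcast. The last clause says that the broadcast of an honest leader carries no
value before the leader has input it. -/
structure IsReliableBroadcast {n : ℕ} {V : Type*} (H : Set (Fin n)) (leader : Fin n)
    (inp : ℕ → Option V) (out : ℕ → Fin n → Option V) : Prop where
  consistency : ∀ i ∈ H, ∀ i' ∈ H, ∀ τ τ' v v',
    out τ i = some v → out τ' i' = some v' → v = v'
  validity : leader ∈ H → ∀ τ v, inp τ = some v → ∀ i ∈ H, ∃ τ', out τ' i = some v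
  totality : ∀ i ∈ H, ∀ τ v, out τ i = some v → ∀ i' ∈ H, ∃ τ', (out τ' i').isSome
  causality : leader ∈ H → ∀ i ∈ H, ∀ τ v, out τ i = some v → inp τ = some v

/-- (Binary) Byzantine agreement. -/
structure IsByzantineAgreement {n : ℕ} {V : Type*} (H : Set (Fin n))
    (inp out : ℕ → Fin n → Option V) : Prop where
  termination : (∀ i ∈ H, ∃ τ, (inp τ i).isSome) → ∀ i ∈ H, ∃ τ, (out τ i).isSome
  consistency : ∀ i ∈ H, ∀ τ v, out τ i = some v → ∀ i' ∈ H, ∃ τ', out τ' i' = some v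
  validity : ∀ v, (∀ i ∈ H, ∃ τ, inp τ i = some v) → ∀ i ∈ H, ∃ τ, out τ i = some v

/-- An instance of the common coin that has the outcome `l`. -/
structure IsCommonCoin {n : ℕ} (t : ℕ) (H : Set (Fin n)) (l : Fin n)
    (active : ℕ → Fin n → Prop) (out : ℕ → Fin n → Option (Fin n)) : Prop where
  termination : (∃ S : Finset (Fin n), ↑S ⊆ H ∧ t + 1 ≤ S.card ∧ ∀ i ∈ S, ∃ τ, active τ i) →
    ∀ i ∈ H, (∃ τ, active τ i) → ∃ τ, (out τ i).isSome
  consistency : ∀ i ∈ H, ∀ τ l', out τ i = some l' → l' = l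

/-! ## Executions -/

/-- `s τ i` is the state of node `i` at time `τ`, and `ev τ` is what happens between the times
`τ` and `τ + 1`. The states and events of nodes outside `H` are arbitrary: such nodes can send
any message to any node at any time. -/
structure IsExecution {n t : ℕ} {A : Type*} (ec : ErasureCode n (t + 1) A) (H : Set (Fin n))
    (w : Fin n → Fin (t + 1) → A) (s : ℕ → Fin n → NodeState n t A)
    (ev : ℕ → Option (Fin n × Event n A)) : Prop where
  init : ∀ i ∈ H, s 0 i = NodeState.init n t A
  step : ∀ i ∈ H, ∀ τ e, ev τ = some (i, e) → e.apply ec i (w i) (s τ i) = some (s (τ + 1) i)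
  stay : ∀ i ∈ H, ∀ τ, (∀ e, ev τ ≠ some (i, e)) → s (τ + 1) i = s τ i
  /-- every honest node receives its input -/
  input : ∀ i ∈ H, ∃ τ, ev τ = some (i, .input)
  /-- channels are authenticated -/
  authentic : ∀ i ∈ H, ∀ p ∈ H, ∀ τ m, ev τ = some (i, .receive p m) → m ∈ (s τ p).sent
  /-- messages between honest nodes eventually arrive -/
  delivery : ∀ i ∈ H, ∀ p ∈ H, ∀ τ m, m ∈ (s τ p).sent → ∃ τ', ev τ' = some (i, .receive p m)
  /-- a local action that stays enabled is eventually taken -/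
  fair : ∀ i ∈ H, ∀ ρ τ, ∃ τ', τ ≤ τ' ∧
    (ev τ' = some (i, .act ρ) ∨ fire ec i ρ (s τ' i) = none)
  /-- the reliable broadcasts of symbols -/
  rbcSym : ∀ j, IsReliableBroadcast H j (fun τ => (s τ j).symIn) (fun τ i => (s τ i).symOut j)
  /-- the reliable broadcasts of vectors -/
  rbcVec : ∀ j, IsReliableBroadcast H j (fun τ => (s τ j).vecIn) (fun τ i => (s τ i).vecOut j)
  /-- the binary agreements -/
  agree : ∀ k, IsByzantineAgreement H (fun τ i => (s τ i).agreeIn k) (fun τ i => (s τ i).agreeOut k)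

/-- The election of each round `r` is a common coin with outcome `coin r`. -/
def Elects {n t : ℕ} {A : Type*} (H : Set (Fin n)) (s : ℕ → Fin n → NodeState n t A)
    (coin : Fin n → Fin n) : Prop :=
  ∀ r, IsCommonCoin t H (coin r) (fun τ i => r ∈ (s τ i).coinOn) (fun τ i => (s τ i).coinOut r)

end OciorABA

namespace OciorABA

open Filter

variable {n t : ℕ} {A : Type*}

/-! ## Monotonicity of the local state -/

/-! Two counting facts run through the argument: among any `t + 1` nodes one is honest, and among
any `n - t` nodes at least `n - 2t ≥ t + 1` are honest.

The dispersal returns at every honest node. If it returned at none, all honest nodes would execute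
it forever; for each honest position, `t + 1` of the at least `2t + 1` honest votes agree, so the
entry gets confirmed everywhere, every honest vector is completed and broadcast, and the chain
through ELECTION and CONFIRM forces a return after all (`exists_honest_returned`). One return
spreads by amplification of CONFIRM (`exists_returned`). Traced backwards, a return rests on `n - t`
ELECTION messages, hence on `n - 2t` honest leaders whose finish indicator is set at `t + 1` honest
nodes (`exists_goodLeaders`).

A biased agreement is given a ready bit and a finish bit, and a finish bit at one honest node
implies ready bits at `t + 1` honest nodes. So either some honest second bit is `1` and enough first
bits are `1`, or all honest second bits are `0`; in both cases the instance answers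
(`biasedOut_terminates`). If `t + 1` honest second bits are `1`, the answer is never `0`
(`biasedOut_ne_false`). An answer `1` goes back to an indicator at an honest node, hence to a
broadcast delivered at some honest node, which totality carries to all.

Therefore all honest nodes pass each round with the same outcome, and a good leader's round ends
with a common vector (`round`). The `n - 2t` good leaders and the `2t + 1` elected nodes must
intersect (`exists_done`). All non-missing entries of the vector obtained were answered `1` at an
honest node, so every symbol needed for decoding arrives everywhere (`terminates_of_done`). -/

/-- The local state `s'` extends the local state `s`. -/
structure NodeState.Le (s s' : NodeState n t A) : Prop where
  sent : s.sent ⊆ s'.sent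
  rcvd : s.rcvd ⊆ s'.rcvd
  syms : s.syms.isSome → s'.syms.isSome
  apvaIn : ∀ j b, s.apvaIn j = some b → s'.apvaIn j = some b
  symOut : ∀ j y, s.symOut j = some y → s'.symOut j = some y
  vecOut : ∀ j v, s.vecOut j = some v → s'.vecOut j = some v
  agreeIn : ∀ k b, s.agreeIn k = some b → s'.agreeIn k = some b
  agreeOut : ∀ k b, s.agreeOut k = some b → s'.agreeOut k = some b
  coinOn : s.coinOn ⊆ s'.coinOn
  coinOut : ∀ r l, s.coinOut r = some l → s'.coinOut r = some l
  R : ∀ b j, s.R b j = true → s'.R b j = true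
  F : ∀ b j, s.F b j = true → s'.F b j = true
  rbcR : ∀ j, s.rbcR j = true → s'.rbcR j = true
  rbcF : ∀ j, s.rbcF j = true → s'.rbcF j = true
  C : ∀ j b, s.C j = some b → s'.C j = some b
  returned : s.returned = true → s'.returned = true
  terminated : s.terminated = true → s'.terminated = true ∧ s'.output = s.output
  biasedIn : ∀ k a, s.biasedIn k = some a → s'.biasedIn k = some a
  biasedOut : ∀ k a, s.biasedOut k = some a → s'.biasedOut k = some a
  -- The rules that set these bits are disabled after the return. Inputs to biased agreements are
  -- read later, so they are the final values of the bits and dominate the values at any time.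
  frozen : s.returned = true →
    s'.R = s.R ∧ s'.F = s.F ∧ s'.rbcR = s.rbcR ∧ s'.rbcF = s.rbcF

theorem NodeState.Le.refl (s : NodeState n t A) : s.Le s := by
  constructor <;> simp

theorem NodeState.Le.trans {s s' s'' : NodeState n t A} (h : s.Le s') (h' : s'.Le s'') :
    s.Le s'' where
  sent := h.sent.trans h'.sent
  rcvd := h.rcvd.trans h'.rcvd
  syms := fun x => h'.syms (h.syms x)
  apvaIn := fun _ _ x => h'.apvaIn _ _ (h.apvaIn _ _ x)
  symOut := fun _ _ x => h'.symOut _ _ (h.symOut _ _ x)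
  vecOut := fun _ _ x => h'.vecOut _ _ (h.vecOut _ _ x)
  agreeIn := fun _ _ x => h'.agreeIn _ _ (h.agreeIn _ _ x)
  agreeOut := fun _ _ x => h'.agreeOut _ _ (h.agreeOut _ _ x)
  coinOn := h.coinOn.trans h'.coinOn
  coinOut := fun _ _ x => h'.coinOut _ _ (h.coinOut _ _ x)
  R := fun _ _ x => h'.R _ _ (h.R _ _ x)
  F := fun _ _ x => h'.F _ _ (h.F _ _ x)
  rbcR := fun _ x => h'.rbcR _ (h.rbcR _ x)
  rbcF := fun _ x => h'.rbcF _ (h.rbcF _ x)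
  C := fun _ _ x => h'.C _ _ (h.C _ _ x)
  returned := fun x => h'.returned (h.returned x)
  terminated := fun x => ⟨(h'.terminated (h.terminated x).1).1,
    ((h'.terminated (h.terminated x).1).2).trans (h.terminated x).2⟩
  biasedIn := fun _ _ x => h'.biasedIn _ _ (h.biasedIn _ _ x)
  biasedOut := fun _ _ x => h'.biasedOut _ _ (h.biasedOut _ _ x)
  frozen := fun x => by
    obtain ⟨a, b, c, d⟩ := h.frozen x
    obtain ⟨a', b', c', d'⟩ := h'.frozen (h.returned x)
    exact ⟨a'.trans a, b'.trans b, c'.trans c, d'.trans d⟩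

theorem NodeState.Le.count {s s' : NodeState n t A} (h : s.Le s') (m : Msg n) :
    s.count m ≤ s'.count m :=
  Finset.card_le_card fun p hp => by
    simp only [Finset.mem_filter, Finset.mem_univ, true_and] at hp ⊢
    exact h.rcvd hp

theorem NodeState.Le.cntFst {s s' : NodeState n t A} (h : s.Le s') (k : BiasedId n) :
    s.cntFst k ≤ s'.cntFst k :=
  Finset.card_le_card fun p hp => by
    simp only [Finset.mem_filter, Finset.mem_univ, true_and] at hp ⊢
    exact hp.imp fun _ x => h.rcvd x

theorem NodeState.Le.cntSnd {s s' : NodeState n t A} (h : s.Le s') (k : BiasedId n) :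
    s.cntSnd k ≤ s'.cntSnd k :=
  Finset.card_le_card fun p hp => by
    simp only [Finset.mem_filter, Finset.mem_univ, true_and] at hp ⊢
    exact hp.imp fun _ x => h.rcvd x

theorem NodeState.Le.cntZero {s s' : NodeState n t A} (h : s.Le s') (k : BiasedId n) :
    s.cntZero k ≤ s'.cntZero k :=
  Finset.card_le_card fun p hp => by
    simp only [Finset.mem_filter, Finset.mem_univ, true_and] at hp ⊢
    exact hp.imp fun _ x => h.rcvd x

theorem NodeState.le_receive (s : NodeState n t A) (p : Fin n) (m : Msg n) :
    s.Le (s.receive p m) := by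
  unfold NodeState.receive
  split
  · split_ifs
    · exact .refl s
    · constructor <;> simp
  · constructor <;> simp

/-- A call writes `1` into the output of a new instance; `hs` guarantees that a new instance had no
output that could be overwritten. -/
theorem NodeState.le_callBiased (s : NodeState n t A) (inp : BiasedId n → Option (Bool × Bool))
    (hs : ∀ k, (s.biasedOut k).isSome → (s.biasedIn k).isSome) :
    s.Le (s.callBiased inp) := by
  unfold NodeState.callBiased
  constructor <;> simp
  · grind
  · intro k
    have := hs k
    grind

theorem NodeState.le_callAgree (s : NodeState n t A) (k : AgreeId n) (b : Bool) :
    s.Le (s.callAgree k b) := by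
  unfold NodeState.callAgree
  constructor <;> simp
  grind

theorem NodeState.le_nextRound (s : NodeState n t A) (r : Fin n) :
    s.Le (s.nextRound r) := by
  unfold NodeState.nextRound NodeState.beginRound
  split_ifs <;> constructor <;> simp

theorem NodeState.Le.withPc {s s' : NodeState n t A} (h : s.Le s') (pc : Pc n) :
    s.Le { s' with pc := pc } := by
  constructor
  all_goals first
    | exact h.1 | exact h.2 | exact h.3 | exact h.4 | exact h.5 | exact h.6 | exact h.7
    | exact h.8 | exact h.9 | exact h.10 | exact h.11 | exact h.12 | exact h.13 | exact h.14
    | exact h.15 | exact h.16 | exact h.17 | exact h.18 | exact h.19 | exact h.20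

theorem update_update_true_apply {α β : Type*} [DecidableEq α] [DecidableEq β]
    (R : α → β → Bool) (b b' : α) (j j' : β) :
    Function.update R b (Function.update (R b) j true) b' j' =
      if b' = b ∧ j' = j then true else R b' j' := by
  by_cases hb : b' = b
  · subst hb
    by_cases hj : j' = j
    · subst hj; simp
    · simp [hj]
  · simp [hb]

theorem le_apvaStep (i : Fin n) {s s' : NodeState n t A}
    (hs : ∀ k, (s.biasedOut k).isSome → (s.biasedIn k).isSome)
    (h : apvaStep i s = some s') : s.Le s' := by
  unfold apvaStep at h
  split at h
  all_goals (repeat' split at h)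
  all_goals first | simp at h; done | skip
  all_goals (simp only [Option.some.injEq] at h; subst h)
  · constructor <;> simp [NodeState.beginRound]
  all_goals first
    | exact s.le_nextRound _
    | exact (NodeState.le_callBiased _ _ hs).withPc _
    | exact (NodeState.le_callAgree _ _ _).withPc _
    | exact (NodeState.Le.refl s).withPc _

theorem le_decideStep (ec : ErasureCode n (t + 1) A) {s s' : NodeState n t A}
    (ht : s.terminated = false) (h : decideStep ec s = some s') : s.Le s' := by
  unfold decideStep at h
  split at h
  · dsimp only at h
    split_ifs at h
    all_goals (simp only [Option.some.injEq] at h; subst h; constructor <;> simp [ht])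
  · simp at h

theorem le_fire (ec : ErasureCode n (t + 1) A) (i : Fin n) (ρ : Rule n) {s s' : NodeState n t A}
    (hs : ∀ k, (s.biasedOut k).isSome → (s.biasedIn k).isSome)
    (h : fire ec i ρ s = some s') : s.Le s' := by
  unfold fire at h
  by_cases ht : s.terminated = true
  · rw [if_pos ht] at h; simp at h
  rw [if_neg ht] at h
  simp only [Bool.not_eq_true] at ht
  cases ρ
  case apva => exact le_apvaStep i hs h
  case decide => exact le_decideStep ec ht h
  all_goals dsimp only at h
  all_goals (repeat' split at h)
  all_goals first | simp at h; done | skip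
  all_goals (simp only [Option.some.injEq] at h; subst h)
  all_goals (constructor <;> try simp [NodeState.send, update_update_true_apply, *])
  all_goals grind

theorem le_apply (ec : ErasureCode n (t + 1) A) (i : Fin n) (w : Fin (t + 1) → A)
    {s s' : NodeState n t A} (e : Event n A)
    (hs : ∀ k, (s.biasedOut k).isSome → (s.biasedIn k).isSome)
    (h : e.apply ec i w s = some s') : s.Le s' := by
  cases e
  case act ρ => exact le_fire ec i ρ hs h
  case receive p m =>
    simp only [Event.apply, Option.some.injEq] at h
    subst h; exact s.le_receive p m
  all_goals simp only [Event.apply] at h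
  all_goals (repeat' split at h)
  all_goals (simp only [Option.some.injEq] at h; subst h)
  · exact .refl s
  all_goals (constructor <;> try simp)
  all_goals grind

/-! ## Local invariants -/

/-- The local invariants of the dispersal protocol at node `i`. -/
structure DispersalInv (i : Fin n) (s : NodeState n t A) : Prop where
  apvaIn : ∀ j, (s.apvaIn j).isSome → (s.symOut j).isSome
  -- A vote is either the node's own input or an amplification; following amplifications back in
  -- time must end at an honest input.
  vote : ∀ j b, Msg.vote j b ∈ s.sent → s.apvaIn j = some b ∨ t + 1 ≤ s.count (.vote j b)
  -- Equivalences for READY and FINISH, because one rule both sends the message and sets the bit: a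
  -- message from an honest node reveals its indicator.
  ready : ∀ j b, Msg.ready j b ∈ s.sent ↔ s.R b j = true
  R : ∀ j b, s.R b j = true → t + 1 ≤ s.count (.vote j b)
  finish : ∀ j b, Msg.finish j b ∈ s.sent ↔ s.F b j = true
  F : ∀ j b, s.F b j = true → n - t ≤ s.count (.ready j b)
  C : ∀ j b, s.C j = some b → n - t ≤ s.count (.finish j b)
  readyRbc : ∀ j, Msg.readyRbc j ∈ s.sent ↔ s.rbcR j = true
  rbcR : ∀ j, s.rbcR j = true → (s.vecOut j).isSome
  finishRbc : ∀ j, Msg.finishRbc j ∈ s.sent ↔ s.rbcF j = true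
  rbcF : ∀ j, s.rbcF j = true → n - t ≤ s.count (.readyRbc j)
  election : Msg.election ∈ s.sent → n - t ≤ s.count (.finishRbc i)
  confirm : Msg.confirm ∈ s.sent → n - t ≤ s.count .election ∨ t + 1 ≤ s.count .confirm
  returned : s.returned = true → Msg.confirm ∈ s.sent ∧ 2 * t + 1 ≤ s.count .confirm
  cnt : s.cnt = (nonMissing s.C).card
  -- The vector is a snapshot taken at the `n - t`-th entry, while `C` may keep growing; hence exact
  -- cardinality for `v` but only inclusion of its entries in `C`.
  vecIn : ∀ v, s.vecIn = some v →
    (nonMissing v).card = n - t ∧ ∀ j b, v j = some b → s.C j = some b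
  -- If `n - t = 0`, the initial state already has the count and no snapshot has been taken; the
  -- guard excludes this.
  vecIn_isSome : 0 < n - t → n - t ≤ s.cnt → s.vecIn.isSome

/-- The invariants of the control point of vector agreement. -/
def PcInv (s : NodeState n t A) : Pc n → Prop
  | .idle => True
  | .electing r => s.returned = true ∧ r ∈ s.coinOn
  | .biased _ l => s.returned = true ∧ (s.biasedIn (.main l)).isSome
  | .agree _ l => s.returned = true ∧ (s.agreeIn (.first l)).isSome
  | .waitVec _ l => s.returned = true ∧ s.agreeOut (.first l) = some true
  | .entries _ l v => s.returned = true ∧ s.vecOut l = some v ∧ n - t ≤ (nonMissing v).card ∧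
      ∀ j ∈ nonMissing v, (s.biasedIn (.entry l j)).isSome
  | .agreeVec _ l v => s.returned = true ∧ s.vecOut l = some v ∧ (s.agreeIn (.second l)).isSome
  | .exhausted => s.returned = true
  | .done _ => s.returned = true

/-- The local invariants of vector agreement. -/
structure ThreadInv (s : NodeState n t A) : Prop where
  biasedOut : ∀ k, (s.biasedOut k).isSome → (s.biasedIn k).isSome
  value : ∀ k a₁ a₂, Msg.value k a₁ a₂ ∈ s.sent ↔ s.biasedIn k = some (a₁, a₂)
  biasedIn_main : ∀ l a₁ a₂, s.biasedIn (.main l) = some (a₁, a₂) →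
    s.returned = true ∧ a₁ = s.rbcR l ∧ a₂ = s.rbcF l
  biasedIn_entry : ∀ l j a₁ a₂, s.biasedIn (.entry l j) = some (a₁, a₂) →
    s.returned = true ∧ ∃ v b, s.vecOut l = some v ∧ v j = some b ∧ a₁ = s.R b j ∧ a₂ = s.F b j
  biasedOut_true : ∀ k, s.biasedOut k = some true →
    (∃ a₁ a₂, s.biasedIn k = some (a₁, a₂) ∧ (a₁ = true ∨ a₂ = true)) ∨
      t + 1 ≤ s.cntFst k ∨ t + 1 ≤ s.cntSnd k
  biasedOut_false : ∀ k, s.biasedOut k = some false → n - t ≤ s.cntZero k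
  agreeIn_first : ∀ l a, s.agreeIn (.first l) = some a → s.biasedOut (.main l) = some a
  agreeIn_second : ∀ l a, s.agreeIn (.second l) = some a → ∃ v, s.vecOut l = some v ∧
    (∀ j ∈ nonMissing v, (s.biasedOut (.entry l j)).isSome) ∧
    (a = true ↔ ∀ j ∈ nonMissing v, s.biasedOut (.entry l j) = some true)
  pc : PcInv s s.pc
  terminated : s.terminated = true → s.output.isSome ∧ ∃ v, s.pc = .done v

/-! ### The invariants hold initially and survive every event -/

theorem nonMissing_update {v : PVec n} {j : Fin n} {b : Bool} (h : v j = none) :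
    (nonMissing (Function.update v j (some b))).card = (nonMissing v).card + 1 := by
  have : nonMissing (Function.update v j (some b)) = insert j (nonMissing v) := by
    ext j'
    by_cases hj : j' = j
    · subst hj; simp [nonMissing]
    · simp [nonMissing, hj]
  rw [this, Finset.card_insert_of_notMem (by simp [nonMissing, h])]

theorem DispersalInv.init (i : Fin n) : DispersalInv i (NodeState.init n t A) := by
  constructor <;> simp [NodeState.init, nonMissing]
  omega

theorem ThreadInv.init : ThreadInv (NodeState.init n t A) := by
  constructor <;> simp [NodeState.init, PcInv]

/-- The dispersal part of the state is not touched, except for received messages, outputs of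
primitives and messages of biased agreements. -/
structure NodeState.SameDispersal (s s' : NodeState n t A) : Prop where
  le : s.Le s'
  apvaIn : s'.apvaIn = s.apvaIn
  sent : ∀ m ∈ s'.sent, m ∈ s.sent ∨ ∃ k a₁ a₂, m = .value k a₁ a₂
  R : s'.R = s.R
  F : s'.F = s.F
  rbcR : s'.rbcR = s.rbcR
  rbcF : s'.rbcF = s.rbcF
  C : s'.C = s.C
  cnt : s'.cnt = s.cnt
  vecIn : s'.vecIn = s.vecIn
  returned : s'.returned = s.returned

theorem Option.isSome_mono {α : Type*} {x y : Option α} (h : ∀ a, x = some a → y = some a) :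
    x.isSome → y.isSome := by
  cases x <;> simp_all

/-- The only new messages are those of biased agreements, which no dispersal invariant mentions, and
the counts in the conclusions of the clauses can only grow. -/
theorem NodeState.SameDispersal.inv {i : Fin n} {s s' : NodeState n t A}
    (h : s.SameDispersal s') (hs : DispersalInv i s) : DispersalInv i s' := by
  have hm : ∀ m, m ∈ s'.sent → (∀ k a₁ a₂, m ≠ .value k a₁ a₂) → m ∈ s.sent := by
    intro m hm hv
    rcases h.sent m hm with h | ⟨k, a₁, a₂, h⟩
    · exact h
    · exact absurd h (hv _ _ _)
  have hc := h.le.count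
  have hsent := h.le.sent
  constructor
  · intro j hj
    rw [h.apvaIn] at hj
    exact Option.isSome_mono (h.le.symOut j) (hs.apvaIn j hj)
  · intro j b hj
    rw [h.apvaIn]
    exact (hs.vote j b (hm _ hj (by simp))).imp id fun x => x.trans (hc _)
  · intro j b
    rw [h.R, ← hs.ready]
    exact ⟨fun x => hm _ x (by simp), fun x => hsent x⟩
  · intro j b hj
    rw [h.R] at hj
    exact (hs.R j b hj).trans (hc _)
  · intro j b
    rw [h.F, ← hs.finish]
    exact ⟨fun x => hm _ x (by simp), fun x => hsent x⟩
  · intro j b hj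
    rw [h.F] at hj
    exact (hs.F j b hj).trans (hc _)
  · intro j b hj
    rw [h.C] at hj
    exact (hs.C j b hj).trans (hc _)
  · intro j
    rw [h.rbcR, ← hs.readyRbc]
    exact ⟨fun x => hm _ x (by simp), fun x => hsent x⟩
  · intro j hj
    rw [h.rbcR] at hj
    exact Option.isSome_mono (h.le.vecOut j) (hs.rbcR j hj)
  · intro j
    rw [h.rbcF, ← hs.finishRbc]
    exact ⟨fun x => hm _ x (by simp), fun x => hsent x⟩
  · intro j hj
    rw [h.rbcF] at hj
    exact (hs.rbcF j hj).trans (hc _)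
  · intro hj
    exact (hs.election (hm _ hj (by simp))).trans (hc _)
  · intro hj
    exact (hs.confirm (hm _ hj (by simp))).imp (fun x => x.trans (hc _)) fun x => x.trans (hc _)
  · intro hj
    rw [h.returned] at hj
    exact ⟨hsent (hs.returned hj).1, (hs.returned hj).2.trans (hc _)⟩
  · rw [h.cnt, h.C, hs.cnt]
  · rw [h.vecIn, h.C]; exact hs.vecIn
  · rw [h.vecIn, h.cnt]; exact hs.vecIn_isSome

theorem sameDispersal_apvaStep {i : Fin n} {s s' : NodeState n t A}
    (hs : ∀ k, (s.biasedOut k).isSome → (s.biasedIn k).isSome)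
    (h : apvaStep i s = some s') : s.SameDispersal s' := by
  have hle := le_apvaStep i hs h
  unfold apvaStep at h
  split at h
  all_goals (repeat' split at h)
  all_goals first | simp at h; done | skip
  all_goals (simp only [Option.some.injEq] at h; subst h)
  all_goals (refine ⟨hle, ?_, ?_, ?_, ?_, ?_, ?_, ?_, ?_, ?_, ?_⟩ <;> clear hle)
  all_goals try unfold NodeState.nextRound
  all_goals (repeat' split)
  all_goals try simp [NodeState.beginRound, NodeState.callBiased, NodeState.callAgree]
  all_goals grind

set_option maxHeartbeats 4000000 in
theorem dispersalInv_fire (ec : ErasureCode n (t + 1) A) (i : Fin n) (ρ : Rule n)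
    {s s' : NodeState n t A}
    (hb : ∀ k, (s.biasedOut k).isSome → (s.biasedIn k).isSome)
    (h : fire ec i ρ s = some s') (hs : DispersalInv i s) : DispersalInv i s' := by
  have hle := le_fire ec i ρ hb h
  have hc := hle.count
  unfold fire at h
  by_cases ht : s.terminated = true
  · rw [if_pos ht] at h; simp at h
  rw [if_neg ht] at h
  cases ρ
  case apva => exact (sameDispersal_apvaStep hb h).inv hs
  case decide =>
    refine NodeState.SameDispersal.inv ?_ hs
    unfold decideStep at h
    dsimp only at h
    (repeat' split at h)
    all_goals first | simp at h; done | skip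
    all_goals
      simp only [Option.some.injEq] at h
      subst h
      constructor <;> first | exact hle | simp
    all_goals exact fun m hm => Or.inl hm
  case biasedOut k =>
    refine NodeState.SameDispersal.inv ?_ hs
    dsimp only at h
    (repeat' split at h)
    all_goals first | simp at h; done | skip
    all_goals
      simp only [Option.some.injEq] at h
      subst h
      constructor <;> first | exact hle | simp
    all_goals exact fun m hm => Or.inl hm
  case confirm j b =>
    dsimp only at h
    split at h
    swap
    · simp at h
    rename_i hj
    simp only [Option.some.injEq] at h
    subst h
    have hcard := nonMissing_update (b := b) hj.2.2
    refine ⟨hs.1, hs.2, hs.3, hs.4, hs.5, hs.6, ?_, hs.8, hs.9, hs.10, hs.11, hs.12, hs.13,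
      hs.14, ?_, ?_, ?_⟩
    · intro j' b' hj'
      dsimp only at hj'
      by_cases hjj : j' = j
      · subst hjj
        simp only [Function.update_self, Option.some.injEq] at hj'
        subst hj'
        exact hj.2.1
      · rw [Function.update_of_ne hjj] at hj'
        exact hs.C j' b' hj'
    · dsimp only
      rw [hcard, hs.cnt]
    · intro v hv
      dsimp only at hv ⊢
      split_ifs at hv with hcnt
      · simp only [Option.some.injEq] at hv
        subst hv
        exact ⟨by rw [hcard, ← hs.cnt, hcnt], fun _ _ x => x⟩
      · exact ⟨(hs.vecIn v hv).1, fun j' b' x => hle.C _ _ ((hs.vecIn v hv).2 _ _ x)⟩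
    · intro h0 h1
      dsimp only at h1 ⊢
      split_ifs with hcnt
      · rfl
      · exact hs.vecIn_isSome h0 (by omega)
  all_goals dsimp only at h
  all_goals (repeat' split at h)
  all_goals first | simp at h; done | skip
  all_goals
    simp only [Option.some.injEq] at h
    clear hle hb hc
    -- None of the remaining rules receives a message, so all counts are unchanged, and each new
    -- message or bit is justified by the guard of its rule.
    have hcnt : ∀ m, s'.count m = s.count m := by subst h; exact fun _ => rfl
    have e1 := congrArg NodeState.sent h
    have e2 := congrArg NodeState.R h
    have e3 := congrArg NodeState.F h
    have e4 := congrArg NodeState.rbcR h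
    have e5 := congrArg NodeState.rbcF h
    have e6 := congrArg NodeState.apvaIn h
    have e7 := congrArg NodeState.symOut h
    have e8 := congrArg NodeState.vecOut h
    have e9 := congrArg NodeState.C h
    have e10 := congrArg NodeState.cnt h
    have e11 := congrArg NodeState.vecIn h
    have e12 := congrArg NodeState.returned h
    clear h
    simp only [NodeState.send] at e1 e2 e3 e4 e5 e6 e7 e8 e9 e10 e11 e12
    obtain ⟨h1, h2, h3, h4, h5, h6, h7, h8, h9, h10, h11, h12, h13, h14, h15, h16, h17⟩ := hs
    constructor
    all_goals
      simp only [hcnt, ← e1, ← e2, ← e3, ← e4, ← e5, ← e6, ← e7, ← e8, ← e9, ← e10, ← e11, ← e12,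
        Set.mem_union, Set.mem_insert_iff, Set.mem_singleton_iff, update_update_true_apply,
        Msg.vote.injEq, Msg.ready.injEq, Msg.finish.injEq, Msg.readyRbc.injEq,
        Msg.finishRbc.injEq, reduceCtorEq, false_or, or_false]
      clear e1 e2 e3 e4 e5 e6 e7 e8 e9 e10 e11 e12 hcnt
      first | assumption | grind

/-- The thread part of the state is not touched. -/
structure NodeState.SameThread (s s' : NodeState n t A) : Prop where
  le : s.Le s'
  sent : ∀ k a₁ a₂, Msg.value k a₁ a₂ ∈ s'.sent → Msg.value k a₁ a₂ ∈ s.sent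
  biasedIn : s'.biasedIn = s.biasedIn
  biasedOut : s'.biasedOut = s.biasedOut
  agreeIn : s'.agreeIn = s.agreeIn
  pc : s'.pc = s.pc
  terminated : s'.terminated = s.terminated
  output : s'.output = s.output

theorem PcInv.mono {s s' : NodeState n t A} (h : s.Le s') {pc : Pc n} (hs : PcInv s pc) :
    PcInv s' pc := by
  have hr := h.returned
  have hb := fun k => Option.isSome_mono (h.biasedIn k)
  have ha := fun k => Option.isSome_mono (h.agreeIn k)
  cases pc <;> simp only [PcInv] at hs ⊢
  · exact ⟨hr hs.1, h.coinOn hs.2⟩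
  · exact ⟨hr hs.1, hb _ hs.2⟩
  · exact ⟨hr hs.1, ha _ hs.2⟩
  · exact ⟨hr hs.1, h.agreeOut _ _ hs.2⟩
  · exact ⟨hr hs.1, h.vecOut _ _ hs.2.1, hs.2.2.1, fun j hj => hb _ (hs.2.2.2 j hj)⟩
  · exact ⟨hr hs.1, h.vecOut _ _ hs.2.1, ha _ hs.2.2⟩
  · exact hr hs
  · exact hr hs

/-- The delicate clauses equate an input of a biased agreement with indicator bits. They survive
because the node had returned when it gave the input, so that `frozen` applies. -/
theorem NodeState.SameThread.inv {s s' : NodeState n t A}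
    (h : s.SameThread s') (hs : ThreadInv s) : ThreadInv s' := by
  constructor
  · rw [h.biasedOut, h.biasedIn]; exact hs.biasedOut
  · intro k a₁ a₂
    rw [h.biasedIn, ← hs.value]
    exact ⟨h.sent k a₁ a₂, fun x => h.le.sent x⟩
  · intro l a₁ a₂ hl
    rw [h.biasedIn] at hl
    obtain ⟨h1, h2⟩ := hs.biasedIn_main l a₁ a₂ hl
    obtain ⟨-, -, e1, e2⟩ := h.le.frozen h1
    rw [e1, e2]
    exact ⟨h.le.returned h1, h2⟩
  · intro l j a₁ a₂ hl
    rw [h.biasedIn] at hl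
    obtain ⟨h1, v, b, h2, h3⟩ := hs.biasedIn_entry l j a₁ a₂ hl
    obtain ⟨e1, e2, -, -⟩ := h.le.frozen h1
    rw [e1, e2]
    exact ⟨h.le.returned h1, v, b, h.le.vecOut _ _ h2, h3⟩
  · intro k hk
    rw [h.biasedOut] at hk
    rw [h.biasedIn]
    exact (hs.biasedOut_true k hk).imp id
      (Or.imp (fun x => x.trans (h.le.cntFst k)) fun x => x.trans (h.le.cntSnd k))
  · intro k hk
    rw [h.biasedOut] at hk
    exact (hs.biasedOut_false k hk).trans (h.le.cntZero k)
  · rw [h.agreeIn, h.biasedOut]; exact hs.agreeIn_first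
  · intro l a hl
    rw [h.agreeIn] at hl
    obtain ⟨v, h1, h2⟩ := hs.agreeIn_second l a hl
    rw [h.biasedOut]
    exact ⟨v, h.le.vecOut _ _ h1, h2⟩
  · rw [h.pc]; exact hs.pc.mono h.le
  · rw [h.terminated, h.output, h.pc]; exact hs.terminated

theorem ThreadInv.callBiased {s : NodeState n t A} (hs : ThreadInv s)
    (inp : BiasedId n → Option (Bool × Bool)) (hr : s.returned = true)
    (hmain : ∀ l a₁ a₂, inp (.main l) = some (a₁, a₂) → a₁ = s.rbcR l ∧ a₂ = s.rbcF l)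
    (hentry : ∀ l j a₁ a₂, inp (.entry l j) = some (a₁, a₂) →
      ∃ v b, s.vecOut l = some v ∧ v j = some b ∧ a₁ = s.R b j ∧ a₂ = s.F b j) :
    ThreadInv (s.callBiased inp) := by
  have hle := s.le_callBiased inp hs.biasedOut
  have hin : ∀ k a, (s.callBiased inp).biasedIn k = some a →
      s.biasedIn k = some a ∨ inp k = some a := by
    intro k a h
    simp only [NodeState.callBiased] at h
    cases h' : s.biasedIn k <;> simp_all
  have hout : ∀ k, (s.callBiased inp).biasedOut k = s.biasedOut k ∨
      (s.callBiased inp).biasedOut k = some true ∧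
      ∃ a₁ a₂, (s.callBiased inp).biasedIn k = some (a₁, a₂) ∧ (a₁ = true ∨ a₂ = true) := by
    intro k
    simp only [NodeState.callBiased]
    split_ifs <;> simp_all
    grind
  refine ⟨?_, ?_, ?_, ?_, ?_, ?_, ?_, ?_, hs.pc.mono hle, hs.terminated⟩
  · intro k hk
    rcases hout k with h | ⟨-, a₁, a₂, h, -⟩
    · rw [h] at hk
      exact Option.isSome_mono (hle.biasedIn k) (hs.biasedOut k hk)
    · simp [h]
  · intro k a₁ a₂
    have := hs.value k a₁ a₂
    simp only [NodeState.callBiased, Set.mem_union, Set.mem_ofPred_eq, Msg.value.injEq]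
    constructor
    · rintro (h | ⟨k', b₁, b₂, h, rfl, rfl, rfl⟩)
      · rw [this.1 h]; rfl
      · rw [h]; split_ifs at h with h'
        simp only [Bool.not_eq_true, Option.isSome_eq_false_iff, Option.isNone_iff_eq_none] at h'
        rw [h']; rfl
    · intro h
      by_cases h' : s.biasedIn k = none
      · rw [h'] at h
        exact Or.inr ⟨k, a₁, a₂, by simpa [h'] using h, rfl, rfl, rfl⟩
      · left
        rw [this]
        cases h'' : s.biasedIn k <;> simp_all
  · intro l a₁ a₂ h
    rcases hin _ _ h with h | h
    · exact hs.biasedIn_main l a₁ a₂ h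
    · exact ⟨hr, hmain l a₁ a₂ h⟩
  · intro l j a₁ a₂ h
    rcases hin _ _ h with h | h
    · exact hs.biasedIn_entry l j a₁ a₂ h
    · exact ⟨hr, hentry l j a₁ a₂ h⟩
  · intro k hk
    rcases hout k with h | ⟨-, h⟩
    · rw [h] at hk
      rcases hs.biasedOut_true k hk with ⟨a₁, a₂, h1, h2⟩ | h
      · exact Or.inl ⟨a₁, a₂, hle.biasedIn _ _ h1, h2⟩
      · exact Or.inr h
    · exact Or.inl h
  · intro k hk
    rcases hout k with h | ⟨h, -⟩
    · rw [h] at hk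
      exact hs.biasedOut_false k hk
    · simp [h] at hk
  · intro l a h
    exact hle.biasedOut _ _ (hs.agreeIn_first l a h)
  · intro l a h
    obtain ⟨v, h1, h2, h3⟩ := hs.agreeIn_second l a h
    refine ⟨v, h1, fun j hj => Option.isSome_mono (hle.biasedOut _) (h2 j hj), h3.trans ?_⟩
    -- All these instances have already answered and answers are never revised, so a new call cannot
    -- change which of them are `1`.
    refine forall₂_congr fun j hj => ⟨hle.biasedOut _ _, fun h => ?_⟩
    obtain ⟨c, hc⟩ := Option.isSome_iff_exists.1 (h2 j hj)
    have := hle.biasedOut _ _ hc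
    rw [hc, ← this, h]

/-- If `l` was elected before, the earlier input is kept and the old clause covers it; otherwise the
new input is the recorded answer. -/
theorem ThreadInv.callAgree_first {s : NodeState n t A} (hs : ThreadInv s) {l : Fin n} {a : Bool}
    (ha : s.biasedOut (.main l) = some a) : ThreadInv (s.callAgree (.first l) a) := by
  have hle := s.le_callAgree (.first l) a
  refine ⟨hs.1, hs.2, hs.3, hs.4, hs.5, hs.6, ?_, ?_, hs.pc.mono hle, hs.terminated⟩
  · intro l' a' h
    have := hs.agreeIn_first l' a'
    simp only [NodeState.callAgree] at h ⊢
    by_cases hl : l' = l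
    · subst hl
      cases h' : s.agreeIn (.first l') <;> simp_all
    · simp_all
  · intro l' a' h
    refine hs.agreeIn_second l' a' ?_
    simpa [NodeState.callAgree] using h

theorem ThreadInv.callAgree_second {s : NodeState n t A} (hs : ThreadInv s) {l : Fin n}
    {v : PVec n} {a : Bool} (hv : s.vecOut l = some v)
    (hout : ∀ j ∈ nonMissing v, (s.biasedOut (.entry l j)).isSome)
    (ha : a = true ↔ ∀ j ∈ nonMissing v, s.biasedOut (.entry l j) = some true) :
    ThreadInv (s.callAgree (.second l) a) := by
  have hle := s.le_callAgree (.second l) a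
  refine ⟨hs.1, hs.2, hs.3, hs.4, hs.5, hs.6, ?_, ?_, hs.pc.mono hle, hs.terminated⟩
  · intro l' a' h
    refine hs.agreeIn_first l' a' ?_
    simpa [NodeState.callAgree] using h
  · intro l' a' h
    by_cases hl : l' = l
    · subst hl
      cases h' : s.agreeIn (.second l') with
      | none =>
        simp only [NodeState.callAgree, Function.update_self, h', Option.none_or,
          Option.some.injEq] at h
        subst h
        exact ⟨v, hv, hout, ha⟩
      | some c =>
        simp only [NodeState.callAgree, Function.update_self, h', Option.some_or,
          Option.some.injEq] at h
        subst h
        exact hs.agreeIn_second l' c h'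
    · refine hs.agreeIn_second l' a' ?_
      simpa [NodeState.callAgree, hl] using h

theorem ThreadInv.withPc {s : NodeState n t A} (hs : ThreadInv s) (ht : s.terminated = false)
    {pc : Pc n} (hpc : PcInv s pc) : ThreadInv { s with pc := pc } := by
  refine ⟨hs.1, hs.2, hs.3, hs.4, hs.5, hs.6, hs.7, hs.8, ?_, ?_⟩
  · cases pc <;> exact hpc
  · intro h; simp [ht] at h

theorem ThreadInv.beginRound {s : NodeState n t A} (hs : ThreadInv s) (ht : s.terminated = false)
    (hr : s.returned = true) (r : Fin n) : ThreadInv (s.beginRound r) := by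
  refine ⟨hs.1, hs.2, hs.3, hs.4, hs.5, hs.6, hs.7, hs.8, ?_, ?_⟩
  · exact ⟨hr, Or.inl rfl⟩
  · intro h; simp [NodeState.beginRound, ht] at h

theorem ThreadInv.nextRound {s : NodeState n t A} (hs : ThreadInv s) (ht : s.terminated = false)
    (hr : s.returned = true) (r : Fin n) : ThreadInv (s.nextRound r) := by
  unfold NodeState.nextRound
  split_ifs
  · exact hs.beginRound ht hr _
  · exact hs.withPc ht hr

theorem callBiased_biasedIn_isSome (s : NodeState n t A)
    {inp : BiasedId n → Option (Bool × Bool)} {k : BiasedId n} (h : (inp k).isSome) :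
    ((s.callBiased inp).biasedIn k).isSome := by
  simp only [NodeState.callBiased]
  cases h' : s.biasedIn k <;> simp [h]

theorem callAgree_agreeIn_isSome (s : NodeState n t A) (k : AgreeId n) (b : Bool) :
    ((s.callAgree k b).agreeIn k).isSome := by
  simp only [NodeState.callAgree, Function.update_self]
  cases s.agreeIn k <;> simp

theorem PcInv.returned {s : NodeState n t A} {pc : Pc n} (h : PcInv s pc) (hpc : pc ≠ .idle) :
    s.returned = true := by
  cases pc
  case idle => exact absurd rfl hpc
  case exhausted => exact h
  case done => exact h
  all_goals exact h.1

theorem threadInv_apvaStep {i : Fin n} {s s' : NodeState n t A} (hs : ThreadInv s)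
    (ht : s.terminated = false) (h : apvaStep i s = some s') : ThreadInv s' := by
  have hpc := hs.pc
  unfold apvaStep at h
  split at h
  all_goals rename_i heq
  all_goals rw [heq] at hpc
  · split at h
    · simp only [Option.some.injEq] at h; subst h
      exact hs.beginRound ht ‹_› _
    · simp at h
  · split at h
    · simp at h
    · simp only [Option.some.injEq] at h; subst h
      refine (hs.callBiased _ hpc.1 ?_ ?_).withPc ht ⟨hpc.1, ?_⟩
      · intro l' a₁ a₂ h
        grind
      · intro l' a₁ a₂ h
        grind
      · exact callBiased_biasedIn_isSome _ (by simp)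
  · split at h
    · simp at h
    · simp only [Option.some.injEq] at h; subst h
      exact (hs.callAgree_first ‹_›).withPc ht ⟨hpc.1, callAgree_agreeIn_isSome _ _ _⟩
  · split at h
    · simp at h
    · simp only [Option.some.injEq] at h; subst h
      exact hs.withPc ht ⟨hpc.1, ‹_›⟩
    · simp only [Option.some.injEq] at h; subst h
      exact hs.nextRound ht hpc.1 _
  · split at h
    · simp at h
    rename_i r l _ v hv
    split_ifs at h with hcard
    · simp only [Option.some.injEq] at h; subst h
      refine (hs.callBiased _ hpc.1 ?_ ?_).withPc ht ⟨hpc.1, hv, hcard, ?_⟩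
      · intro l' a₁ a₂ h
        simp at h
      · intro l' j a₁ a₂ h
        dsimp only at h
        split_ifs at h with hl
        subst hl
        simp only [Option.map_eq_some_iff, Prod.mk.injEq] at h
        obtain ⟨b, h1, h2, h3⟩ := h
        exact ⟨v, b, hv, h1, h2.symm, h3.symm⟩
      · intro j hj
        refine callBiased_biasedIn_isSome _ ?_
        simpa [nonMissing] using hj
    · simp only [Option.some.injEq] at h; subst h
      exact hs.nextRound ht hpc.1 _
  · split_ifs at h with hall
    simp only [Option.some.injEq] at h; subst h
    exact (hs.callAgree_second hpc.2.1 hall (by simp)).withPc ht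
      ⟨hpc.1, hpc.2.1, callAgree_agreeIn_isSome _ _ _⟩
  · split at h
    · simp at h
    · simp only [Option.some.injEq] at h; subst h
      exact hs.withPc ht hpc.1
    · simp only [Option.some.injEq] at h; subst h
      exact hs.nextRound ht hpc.1 _
  · simp at h
  · simp at h

theorem threadInv_fire (ec : ErasureCode n (t + 1) A) (i : Fin n) (ρ : Rule n)
    {s s' : NodeState n t A} (h : fire ec i ρ s = some s') (hs : ThreadInv s) : ThreadInv s' := by
  have hle := le_fire ec i ρ hs.biasedOut h
  unfold fire at h
  by_cases ht : s.terminated = true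
  · rw [if_pos ht] at h; simp at h
  rw [if_neg ht] at h
  simp only [Bool.not_eq_true] at ht
  cases ρ
  case apva => exact threadInv_apvaStep hs ht h
  case decide =>
    unfold decideStep at h
    dsimp only at h
    (repeat' split at h)
    all_goals first | simp at h; done | skip
    all_goals
      simp only [Option.some.injEq] at h
      subst h
      exact ⟨hs.1, hs.2, hs.3, hs.4, hs.5, hs.6, hs.7, hs.8, hs.pc.mono hle,
        fun _ => ⟨rfl, _, ‹_›⟩⟩
  case biasedOut k =>
    dsimp only at h
    split_ifs at h with hk h1 h2
    · simp only [Option.some.injEq] at h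
      subst h
      refine ⟨?_, hs.2, hs.3, hs.4, ?_, ?_, ?_, ?_, hs.pc.mono hle, hs.10⟩
      · intro k' hk'
        by_cases e : k' = k
        · subst e; exact hk.1
        · exact hs.biasedOut k' (by simpa [e] using hk')
      · intro k' hk'
        by_cases e : k' = k
        · subst e; exact Or.inr h1
        · exact hs.biasedOut_true k' (by simpa [e] using hk')
      · intro k' hk'
        by_cases e : k' = k
        · subst e; simp at hk'
        · exact hs.biasedOut_false k' (by simpa [e] using hk')
      · intro l a ha
        exact hle.biasedOut _ _ (hs.agreeIn_first l a ha)
      · intro l a ha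
        obtain ⟨v, h1, h2, h3⟩ := hs.agreeIn_second l a ha
        refine ⟨v, h1, fun j hj => Option.isSome_mono (hle.biasedOut _) (h2 j hj), h3.trans ?_⟩
        -- The rule answers an instance that had no output, whereas `entry l j` has one, so it is a
        -- different instance.
        refine forall₂_congr fun j hj => ?_
        have := h2 j hj
        grind
    · simp only [Option.some.injEq] at h
      subst h
      refine ⟨?_, hs.2, hs.3, hs.4, ?_, ?_, ?_, ?_, hs.pc.mono hle, hs.10⟩
      · intro k' hk'
        by_cases e : k' = k
        · subst e; exact hk.1
        · exact hs.biasedOut k' (by simpa [e] using hk')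
      · intro k' hk'
        by_cases e : k' = k
        · subst e; simp at hk'
        · exact hs.biasedOut_true k' (by simpa [e] using hk')
      · intro k' hk'
        by_cases e : k' = k
        · subst e; exact h2
        · exact hs.biasedOut_false k' (by simpa [e] using hk')
      · intro l a ha
        exact hle.biasedOut _ _ (hs.agreeIn_first l a ha)
      · intro l a ha
        obtain ⟨v, h1, h2, h3⟩ := hs.agreeIn_second l a ha
        refine ⟨v, h1, fun j hj => Option.isSome_mono (hle.biasedOut _) (h2 j hj), h3.trans ?_⟩
        refine forall₂_congr fun j hj => ?_
        have := h2 j hj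
        grind
  all_goals dsimp only at h
  all_goals (repeat' split at h)
  all_goals first | simp at h; done | skip
  all_goals
    simp only [Option.some.injEq] at h
    refine NodeState.SameThread.inv ?_ hs
    subst h
    refine ⟨hle, ?_, rfl, rfl, rfl, rfl, rfl, rfl⟩
    intro k a₁ a₂ hm
    simpa [NodeState.send] using hm

theorem NodeState.sameThread_receive {s : NodeState n t A} (p : Fin n) (m : Msg n) :
    s.SameThread (s.receive p m) := by
  refine ⟨s.le_receive p m, ?_, ?_, ?_, ?_, ?_, ?_, ?_⟩ <;>
    (unfold NodeState.receive; split) <;> (try split_ifs) <;> simp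

theorem NodeState.sameDispersal_receive {s : NodeState n t A} (p : Fin n) (m : Msg n) :
    s.SameDispersal (s.receive p m) := by
  refine ⟨s.le_receive p m, ?_, ?_, ?_, ?_, ?_, ?_, ?_, ?_, ?_, ?_⟩ <;>
    (unfold NodeState.receive; split) <;> (try split_ifs) <;> simp <;>
    exact fun _ => Or.inl

/-- The local invariants of node `i`. -/
structure LocalInv (i : Fin n) (s : NodeState n t A) : Prop extends
  DispersalInv i s, ThreadInv s

theorem localInv_apply (ec : ErasureCode n (t + 1) A) (i : Fin n) (w : Fin (t + 1) → A)
    {s s' : NodeState n t A} (e : Event n A) (h : e.apply ec i w s = some s')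
    (hs : LocalInv i s) : LocalInv i s' := by
  have hle := le_apply ec i w e hs.biasedOut h
  cases e
  case act ρ =>
    exact ⟨dispersalInv_fire ec i ρ hs.biasedOut h hs.toDispersalInv,
      threadInv_fire ec i ρ h hs.toThreadInv⟩
  case receive p m =>
    simp only [Event.apply, Option.some.injEq] at h
    subst h
    exact ⟨(s.sameDispersal_receive p m).inv hs.toDispersalInv,
      (s.sameThread_receive p m).inv hs.toThreadInv⟩
  all_goals simp only [Event.apply] at h
  all_goals (repeat' split at h)
  all_goals (simp only [Option.some.injEq] at h; subst h)
  · exact hs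
  all_goals
    exact ⟨NodeState.SameDispersal.inv ⟨hle, rfl, fun _ => Or.inl, rfl, rfl, rfl, rfl, rfl, rfl,
      rfl, rfl⟩ hs.toDispersalInv, NodeState.SameThread.inv ⟨hle, fun _ _ _ => id, rfl, rfl, rfl,
      rfl, rfl, rfl⟩ hs.toThreadInv⟩

/-! ## Counting honest nodes -/

section Counting

variable {H : Set (Fin n)} {P : Fin n → Prop}

-- Nodes satisfying `P` outside `H` number at most `t`. This turns the thresholds `t + 1` and `n -
-- t` into one honest witness and `n - 2t` honest witnesses respectively.
open Classical in
theorem card_filter_le_honest [DecidablePred P] (hH : Hᶜ.ncard ≤ t) :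
    (Finset.univ.filter P).card ≤ (Finset.univ.filter fun p => p ∈ H ∧ P p).card + t := by
  have h1 : Hᶜ.ncard = (Finset.univ.filter fun p => p ∉ H).card := by
    rw [← Set.ncard_coe_finset]
    congr 1
    ext; simp
  have h2 : Finset.univ.filter P ⊆ (Finset.univ.filter fun p => p ∈ H ∧ P p) ∪
      (Finset.univ.filter fun p => p ∉ H) := by
    intro p hp
    simp only [Finset.mem_filter, Finset.mem_univ, true_and, Finset.mem_union] at hp ⊢
    tauto
  have h3 := (Finset.card_le_card h2).trans (Finset.card_union_le _ _)
  omega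

theorem exists_honest {_ : DecidablePred P} (hH : Hᶜ.ncard ≤ t)
    (h : t + 1 ≤ (Finset.univ.filter P).card) :
    ∃ p ∈ H, P p := by
  classical
  have h1 := card_filter_le_honest (P := P) hH
  obtain ⟨p, hp⟩ := Finset.card_pos.1
    (show 0 < (Finset.univ.filter fun p => p ∈ H ∧ P p).card by omega)
  simp only [Finset.mem_filter, Finset.mem_univ, true_and] at hp
  exact ⟨p, hp⟩

theorem exists_finset_honest {_ : DecidablePred P} (hH : Hᶜ.ncard ≤ t)
    (h : n - t ≤ (Finset.univ.filter P).card) :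
    ∃ S : Finset (Fin n), n - 2 * t ≤ S.card ∧ ∀ p ∈ S, p ∈ H ∧ P p := by
  classical
  have h1 := card_filter_le_honest (P := P) hH
  refine ⟨Finset.univ.filter fun p => p ∈ H ∧ P p, by omega, fun p hp => ?_⟩
  simpa using hp

theorem card_filter_of_honest [DecidablePred P] (hH : Hᶜ.ncard ≤ t) (h : ∀ p ∈ H, P p) :
    n - t ≤ (Finset.univ.filter P).card := by
  classical
  have h1 := card_filter_le_honest (P := fun p => p ∈ H) hH
  have h2 : (Finset.univ.filter fun p => p ∉ H).card ≤ t := by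
    rw [← Set.ncard_coe_finset]
    convert hH using 2
    ext; simp
  have h3 := Finset.card_filter_add_card_filter_not (s := (Finset.univ : Finset (Fin n)))
    (fun p => p ∈ H)
  rw [Finset.card_univ, Fintype.card_fin] at h3
  have h4 : (Finset.univ.filter fun p => p ∈ H).card ≤ (Finset.univ.filter P).card :=
    Finset.card_le_card (Finset.monotone_filter_right _ fun p _ hp => h p hp)
  omega

theorem exists_honest_finset (hH : Hᶜ.ncard ≤ t) :
    ∃ S : Finset (Fin n), n - t ≤ S.card ∧ ∀ p, p ∈ S ↔ p ∈ H := by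
  classical
  exact ⟨Finset.univ.filter fun p => p ∈ H, card_filter_of_honest hH fun _ h => h, by simp⟩

end Counting

/-! ## Executions -/

/-- Needed to show that a thread which takes no step stays exactly where it is, whatever else
happens at the node. -/
theorem pc_apply (ec : ErasureCode n (t + 1) A) (i : Fin n) (w : Fin (t + 1) → A)
    {s s' : NodeState n t A} (e : Event n A) (h : e.apply ec i w s = some s')
    (hpc : s'.pc ≠ s.pc) : e = .act .apva := by
  by_contra hne
  apply hpc
  cases e
  case act ρ =>
    cases ρ
    case apva => exact absurd rfl hne
    all_goals
      simp only [Event.apply, fire] at h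
      split at h
      · simp at h
    case decide =>
      unfold decideStep at h
      dsimp only at h
      (repeat' split at h)
      all_goals first | simp at h; done | skip
      all_goals (simp only [Option.some.injEq] at h; subst h; rfl)
    all_goals (repeat' split at h)
    all_goals first | simp at h; done | skip
    all_goals (simp only [Option.some.injEq] at h; subst h; rfl)
  case receive p m =>
    simp only [Event.apply, Option.some.injEq] at h
    subst h
    exact (s.sameThread_receive p m).pc
  all_goals simp only [Event.apply] at h
  all_goals (repeat' split at h)
  all_goals (simp only [Option.some.injEq] at h; subst h; rfl)

namespace IsExecution

variable {ec : ErasureCode n (t + 1) A} {H : Set (Fin n)} {w : Fin n → Fin (t + 1) → A}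
  {s : ℕ → Fin n → NodeState n t A} {ev : ℕ → Option (Fin n × Event n A)}

theorem step_cases (hx : IsExecution ec H w s ev) {i : Fin n} (hi : i ∈ H) (τ : ℕ) :
    s (τ + 1) i = s τ i ∨ ∃ e, ev τ = some (i, e) ∧
      e.apply ec i (w i) (s τ i) = some (s (τ + 1) i) := by
  by_cases h : ∃ e, ev τ = some (i, e)
  · obtain ⟨e, he⟩ := h
    exact Or.inr ⟨e, he, hx.step i hi τ e he⟩
  · exact Or.inl (hx.stay i hi τ fun e he => h ⟨e, he⟩)

theorem localInv (hx : IsExecution ec H w s ev) {i : Fin n} (hi : i ∈ H) (τ : ℕ) :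
    LocalInv i (s τ i) := by
  induction τ with
  | zero => rw [hx.init i hi]; exact ⟨DispersalInv.init i, ThreadInv.init⟩
  | succ τ ih =>
    rcases hx.step_cases hi τ with h | ⟨e, -, he⟩
    · rw [h]; exact ih
    · exact localInv_apply ec i (w i) e he ih

theorem mono (hx : IsExecution ec H w s ev) {i : Fin n} (hi : i ∈ H) {τ τ' : ℕ} (h : τ ≤ τ') :
    (s τ i).Le (s τ' i) := by
  induction h with
  | refl => exact .refl _
  | step _ ih =>
    refine ih.trans ?_
    rcases hx.step_cases hi _ with h | ⟨e, -, he⟩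
    · rw [h]; exact .refl _
    · exact le_apply ec i (w i) e (hx.localInv hi _).biasedOut he

theorem eventually_of_mono (hx : IsExecution ec H w s ev) {i : Fin n} (hi : i ∈ H)
    {P : NodeState n t A → Prop} (hP : ∀ x y : NodeState n t A, x.Le y → P x → P y)
    {τ : ℕ} (h : P (s τ i)) : ∀ᶠ τ' in atTop, P (s τ' i) :=
  eventually_atTop.2 ⟨τ, fun _ hτ => hP _ _ (hx.mono hi hτ) h⟩

/-- Only a receive event enlarges `rcvd`, and authenticity applies at that moment. The strict
inequality makes tracing amplified messages backwards in time well founded. -/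
theorem sent_of_rcvd (hx : IsExecution ec H w s ev) {i p : Fin n} (hi : i ∈ H) (hp : p ∈ H)
    {τ : ℕ} {m : Msg n} (h : (p, m) ∈ (s τ i).rcvd) : ∃ τ' < τ, m ∈ (s τ' p).sent := by
  induction τ with
  | zero => rw [hx.init i hi] at h; simp [NodeState.init] at h
  | succ τ ih =>
    by_cases h' : (p, m) ∈ (s τ i).rcvd
    · obtain ⟨τ', h1, h2⟩ := ih h'
      exact ⟨τ', by omega, h2⟩
    refine ⟨τ, by omega, ?_⟩
    rcases hx.step_cases hi τ with h2 | ⟨e, he, he'⟩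
    · rw [h2] at h; exact absurd h h'
    cases e
    case receive p' m' =>
      have hauth : p' ∈ H → m' ∈ (s τ p').sent := fun hp' => hx.authentic i hi p' hp' τ m' he
      simp only [Event.apply, Option.some.injEq] at he'
      rw [← he'] at h
      unfold NodeState.receive at h
      have key : (p, m) ∈ insert (p', m') (s τ i).rcvd → m ∈ (s τ p).sent := by
        rintro (h2 | h2)
        · obtain ⟨rfl, rfl⟩ := Prod.mk.inj h2
          exact hauth hp
        · exact absurd h2 h'
      split at h
      · split_ifs at h
        · exact absurd h h'
        · exact key h
      · exact key h
    case act ρ =>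
      exfalso
      apply h'
      simp only [Event.apply, fire] at he'
      split at he'
      · simp at he'
      cases ρ
      case apva =>
        unfold apvaStep at he'
        dsimp only at he'
        split at he'
        all_goals (repeat' split at he')
        all_goals first | simp at he'; done | skip
        all_goals (simp only [Option.some.injEq] at he'; rw [← he'] at h)
        all_goals try unfold NodeState.nextRound at h
        all_goals try split at h
        all_goals exact h
      case decide =>
        unfold decideStep at he'
        dsimp only at he'
        (repeat' split at he')
        all_goals first | simp at he'; done | skip
        all_goals (simp only [Option.some.injEq] at he'; rw [← he'] at h; exact h)
      all_goals dsimp only at he'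
      all_goals (repeat' split at he')
      all_goals first | simp at he'; done | skip
      all_goals (simp only [Option.some.injEq] at he'; rw [← he'] at h; exact h)
    all_goals
      exfalso
      apply h'
      simp only [Event.apply] at he'
    all_goals (repeat' split at he')
    all_goals (simp only [Option.some.injEq] at he'; rw [← he'] at h; exact h)

theorem sent_of_rcvd' (hx : IsExecution ec H w s ev) {i p : Fin n} (hi : i ∈ H) (hp : p ∈ H)
    {τ : ℕ} {m : Msg n} (h : (p, m) ∈ (s τ i).rcvd) : m ∈ (s τ p).sent := by
  obtain ⟨τ', h1, h2⟩ := hx.sent_of_rcvd hi hp h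
  exact (hx.mono hp h1.le).sent h2

theorem eventually_rcvd (hx : IsExecution ec H w s ev) {i p : Fin n} (hi : i ∈ H) (hp : p ∈ H)
    {τ : ℕ} {m : Msg n} (h : m ∈ (s τ p).sent) : ∀ᶠ τ' in atTop, (p, m) ∈ (s τ' i).rcvd := by
  obtain ⟨τ', hτ'⟩ := hx.delivery i hi p hp τ m h
  refine hx.eventually_of_mono hi (P := fun x => (p, m) ∈ x.rcvd) (fun x y hxy h => hxy.rcvd h)
    (τ := τ' + 1) ?_
  have hs := hx.step i hi τ' _ hτ'
  simp only [Event.apply, Option.some.injEq] at hs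
  rw [← hs]
  unfold NodeState.receive
  split
  · rename_i k a₁ a₂
    split_ifs with hex
    -- A later value message is ignored, but an honest node sends only one per instance, namely its
    -- input, so the recorded message is `m` itself.
    · obtain ⟨b₁, b₂, hb⟩ := hex
      have h1 := (hx.mono hp (le_max_left τ' τ)).sent (hx.sent_of_rcvd' hi hp hb)
      have h2 := (hx.mono hp (le_max_right τ' τ)).sent h
      rw [(hx.localInv hp _).value] at h1 h2
      rw [h1] at h2
      simp only [Option.some.injEq, Prod.mk.injEq] at h2
      rw [← h2.1, ← h2.2]
      exact hb
    · exact Set.mem_insert _ _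
  · exact Set.mem_insert _ _

theorem eventually_forall_rcvd (hx : IsExecution ec H w s ev) {i : Fin n} (hi : i ∈ H)
    {m : Msg n} {S : Finset (Fin n)} (hS : ∀ p ∈ S, p ∈ H ∧ ∃ τ, m ∈ (s τ p).sent) :
    ∀ᶠ τ in atTop, S.card ≤ (s τ i).count m := by
  have : ∀ᶠ τ in atTop, ∀ p ∈ S, (p, m) ∈ (s τ i).rcvd := by
    rw [eventually_all_finset]
    intro p hp
    obtain ⟨h1, τ, h2⟩ := hS p hp
    exact hx.eventually_rcvd hi h1 h2
  filter_upwards [this] with τ hτ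
  exact Finset.card_le_card fun p hp => by simpa using hτ p hp

theorem eventually_count (hx : IsExecution ec H w s ev) (hH : Hᶜ.ncard ≤ t) {i : Fin n}
    (hi : i ∈ H) {m : Msg n} (hm : ∀ p ∈ H, ∃ τ, m ∈ (s τ p).sent) :
    ∀ᶠ τ in atTop, n - t ≤ (s τ i).count m := by
  obtain ⟨S, hS, hS'⟩ := exists_honest_finset hH
  filter_upwards [hx.eventually_forall_rcvd hi (S := S)
    fun p hp => ⟨(hS' p).1 hp, hm p ((hS' p).1 hp)⟩] with τ hτ
  exact hS.trans hτ

/-! ### From fairness to progress -/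

/-- At some late time fairness makes the rule fire or finds it disabled. Firing yields `P`; being
disabled leaves only the alternative that `P` already holds. -/
theorem reach (hx : IsExecution ec H w s ev) {i : Fin n} (hi : i ∈ H) (ρ : Rule n)
    {P : NodeState n t A → Prop}
    (h : ∀ᶠ τ in atTop, P (s τ i) ∨ ∃ x, fire ec i ρ (s τ i) = some x ∧ P x) :
    ∃ τ, P (s τ i) := by
  obtain ⟨τ, hτ⟩ := eventually_atTop.1 h
  obtain ⟨τ', h1, h2⟩ := hx.fair i hi ρ τ
  rcases hτ τ' h1 with h3 | ⟨x, h3, h4⟩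
  · exact ⟨τ', h3⟩
  rcases h2 with h2 | h2
  · have := hx.step i hi τ' _ h2
    simp only [Event.apply] at this
    rw [h3, Option.some.injEq] at this
    exact ⟨τ' + 1, this ▸ h4⟩
  · rw [h3] at h2; simp at h2

/-- If no step were taken at `X`, the control point would remain `X` forever, so by `hlive` the step
would be permanently enabled, against fairness. Excluding `done` excludes termination, which would
block the rule. -/
theorem apva_progress (hx : IsExecution ec H w s ev) {i : Fin n} (hi : i ∈ H) {τ : ℕ} {X : Pc n}
    (hX : (s τ i).pc = X) (hdone : ∀ v, X ≠ .done v)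
    (hlive : (∀ τ' ≥ τ, (s τ' i).pc = X) → ∀ᶠ τ' in atTop, (apvaStep i (s τ' i)).isSome) :
    ∃ τ' ≥ τ, (s τ' i).pc = X ∧ apvaStep i (s τ' i) = some (s (τ' + 1) i) := by
  have hterm : ∀ τ', (s τ' i).pc = X → (s τ' i).terminated = false := by
    intro τ' h
    by_contra hne
    obtain ⟨-, v, hv⟩ := (hx.localInv hi τ').terminated (by simpa using hne)
    exact hdone v (h ▸ hv)
  have hstep : ∀ τ', (s τ' i).pc = X → ev τ' = some (i, .act .apva) →
      apvaStep i (s τ' i) = some (s (τ' + 1) i) := by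
    intro τ' h he
    have := hx.step i hi τ' _ he
    simp only [Event.apply, fire, hterm τ' h] at this
    simpa using this
  by_contra! hcon
  have hstay : ∀ τ' ≥ τ, (s τ' i).pc = X := by
    intro τ' hτ'
    induction τ', hτ' using Nat.le_induction with
    | base => exact hX
    | succ k hk ih =>
      by_contra hne
      rcases hx.step_cases hi k with h | ⟨e, he, he'⟩
      · rw [h] at hne; exact hne ih
      · have := pc_apply ec i (w i) e he' (by rw [ih]; exact hne)
        subst this
        exact hcon k hk ih (hstep k ih he)
  obtain ⟨τ₁, hτ₁⟩ := eventually_atTop.1 (hlive hstay)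
  obtain ⟨τ', h1, h2⟩ := hx.fair i hi .apva (max τ τ₁)
  have h3 := hstay τ' (by omega)
  rcases h2 with h2 | h2
  · exact hcon τ' (by omega) h3 (hstep τ' h3 h2)
  · have h4 := hτ₁ τ' (by omega)
    simp only [fire, hterm τ' h3] at h2
    simp at h2
    simp [h2] at h4

end IsExecution

namespace IsExecution

variable {ec : ErasureCode n (t + 1) A} {H : Set (Fin n)} {w : Fin n → Fin (t + 1) → A}
  {s : ℕ → Fin n → NodeState n t A} {ev : ℕ → Option (Fin n × Event n A)}

/-! ## The dispersal returns at every honest node -/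

theorem terminated_returned (hx : IsExecution ec H w s ev) {i : Fin n} (hi : i ∈ H) {τ : ℕ}
    (h : (s τ i).terminated = true) : (s τ i).returned = true := by
  obtain ⟨-, v, hv⟩ := (hx.localInv hi τ).terminated h
  exact (hx.localInv hi τ).pc.returned (by simp [hv])

theorem not_terminated (hx : IsExecution ec H w s ev) {i : Fin n} (hi : i ∈ H) {τ : ℕ}
    (hr : (s τ i).returned = false) : (s τ i).terminated = false := by
  by_contra h
  simp [hx.terminated_returned hi (by simpa using h)] at hr

/-- Here and up to `exists_election`, `hr` is the assumption of a proof by contradiction: a node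
that never returns never terminates, so a rule can be blocked only by its threshold or by having
acted already. -/
theorem exists_apvaIn (hx : IsExecution ec H w s ev) {i : Fin n} (hi : i ∈ H)
    (hr : ∀ τ, (s τ i).returned = false) {j : Fin n} (hy : ∃ τ, (s τ i).syms.isSome)
    (ho : ∃ τ, ((s τ i).symOut j).isSome) : ∃ τ, ((s τ i).apvaIn j).isSome := by
  obtain ⟨τ₁, hy⟩ := hy
  obtain ⟨τ₂, ho⟩ := ho
  have ht : ∀ τ, (s τ i).terminated = false := fun τ => hx.not_terminated hi (hr τ)
  refine hx.reach hi (.passInput j) (P := fun x => (x.apvaIn j).isSome) ?_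
  filter_upwards [hx.eventually_of_mono hi (P := fun x => x.syms.isSome)
    (fun x y h => h.syms) hy, hx.eventually_of_mono hi (P := fun x => (x.symOut j).isSome)
    (fun x y h => Option.isSome_mono (h.symOut j)) ho] with τ h1 h2
  obtain ⟨ys, h1⟩ := Option.isSome_iff_exists.1 h1
  obtain ⟨y, h2⟩ := Option.isSome_iff_exists.1 h2
  by_cases h : (s τ i).apvaIn j = none
  · right
    simp [fire, ht, h1, h2, h]
  · left; exact Option.isSome_iff_ne_none.2 h

theorem exists_vote (hx : IsExecution ec H w s ev) {i : Fin n} (hi : i ∈ H)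
    (hr : ∀ τ, (s τ i).returned = false) {j : Fin n} {b : Bool} (hy : ∃ τ, (s τ i).apvaIn j = some b) :
    ∃ τ, Msg.vote j b ∈ (s τ i).sent := by
  obtain ⟨τ₁, hy⟩ := hy
  have ht : ∀ τ, (s τ i).terminated = false := fun τ => hx.not_terminated hi (hr τ)
  refine hx.reach hi (.vote j b) (P := fun x => Msg.vote j b ∈ x.sent) ?_
  filter_upwards [hx.eventually_of_mono hi (P := fun x => x.apvaIn j = some b)
    (fun x y h => h.apvaIn j b) hy] with τ h1
  by_cases h : Msg.vote j b ∈ (s τ i).sent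
  · exact Or.inl h
  · right
    simp [fire, ht, hr, h1, h, NodeState.send]

theorem exists_ready (hx : IsExecution ec H w s ev) {i : Fin n} (hi : i ∈ H)
    (hr : ∀ τ, (s τ i).returned = false) {j : Fin n} {b : Bool}
    (hc : ∀ᶠ τ in atTop, t + 1 ≤ (s τ i).count (.vote j b)) :
    ∃ τ, Msg.ready j b ∈ (s τ i).sent := by
  have ht : ∀ τ, (s τ i).terminated = false := fun τ => hx.not_terminated hi (hr τ)
  refine hx.reach hi (.ready j b) (P := fun x => Msg.ready j b ∈ x.sent) ?_
  filter_upwards [hc] with τ h1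
  by_cases h : (s τ i).R b j = true
  · exact Or.inl (((hx.localInv hi τ).ready j b).2 h)
  · right
    simp [fire, ht, hr, h1, h, NodeState.send]

theorem exists_finish (hx : IsExecution ec H w s ev) {i : Fin n} (hi : i ∈ H)
    (hr : ∀ τ, (s τ i).returned = false) {j : Fin n} {b : Bool}
    (hc : ∀ᶠ τ in atTop, n - t ≤ (s τ i).count (.ready j b)) :
    ∃ τ, Msg.finish j b ∈ (s τ i).sent := by
  have ht : ∀ τ, (s τ i).terminated = false := fun τ => hx.not_terminated hi (hr τ)
  refine hx.reach hi (.finish j b) (P := fun x => Msg.finish j b ∈ x.sent) ?_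
  filter_upwards [hc] with τ h1
  by_cases h : (s τ i).F b j = true
  · exact Or.inl (((hx.localInv hi τ).finish j b).2 h)
  · right
    simp only [fire, ht, hr, h1, h, NodeState.send]
    simp

theorem exists_C (hx : IsExecution ec H w s ev) {i : Fin n} (hi : i ∈ H)
    (hr : ∀ τ, (s τ i).returned = false) {j : Fin n} {b : Bool}
    (hc : ∀ᶠ τ in atTop, n - t ≤ (s τ i).count (.finish j b)) :
    ∃ τ, ((s τ i).C j).isSome := by
  have ht : ∀ τ, (s τ i).terminated = false := fun τ => hx.not_terminated hi (hr τ)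
  refine hx.reach hi (.confirm j b) (P := fun x => (x.C j).isSome) ?_
  filter_upwards [hc] with τ h1
  by_cases h : (s τ i).C j = none
  · right
    simp only [fire, ht, hr, h1, h]
    simp
  · left; exact Option.isSome_iff_ne_none.2 h

theorem exists_readyRbc (hx : IsExecution ec H w s ev) {i : Fin n} (hi : i ∈ H)
    (hr : ∀ τ, (s τ i).returned = false) {j : Fin n} (ho : ∃ τ, ((s τ i).vecOut j).isSome) :
    ∃ τ, Msg.readyRbc j ∈ (s τ i).sent := by
  obtain ⟨τ₁, ho⟩ := ho
  have ht : ∀ τ, (s τ i).terminated = false := fun τ => hx.not_terminated hi (hr τ)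
  refine hx.reach hi (.rbcReady j) (P := fun x => Msg.readyRbc j ∈ x.sent) ?_
  filter_upwards [hx.eventually_of_mono hi (P := fun x => (x.vecOut j).isSome)
    (fun x y h => Option.isSome_mono (h.vecOut j)) ho] with τ h1
  by_cases h : (s τ i).rbcR j = true
  · exact Or.inl (((hx.localInv hi τ).readyRbc j).2 h)
  · right
    simp [fire, ht, hr, h1, h, NodeState.send]

theorem exists_finishRbc (hx : IsExecution ec H w s ev) {i : Fin n} (hi : i ∈ H)
    (hr : ∀ τ, (s τ i).returned = false) {j : Fin n}
    (hc : ∀ᶠ τ in atTop, n - t ≤ (s τ i).count (.readyRbc j)) :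
    ∃ τ, Msg.finishRbc j ∈ (s τ i).sent := by
  have ht : ∀ τ, (s τ i).terminated = false := fun τ => hx.not_terminated hi (hr τ)
  refine hx.reach hi (.rbcFinish j) (P := fun x => Msg.finishRbc j ∈ x.sent) ?_
  filter_upwards [hc] with τ h1
  by_cases h : (s τ i).rbcF j = true
  · exact Or.inl (((hx.localInv hi τ).finishRbc j).2 h)
  · right
    simp only [fire, ht, hr, h1, h, NodeState.send]
    simp

theorem exists_election (hx : IsExecution ec H w s ev) {i : Fin n} (hi : i ∈ H)
    (hr : ∀ τ, (s τ i).returned = false) (hc : ∀ᶠ τ in atTop, n - t ≤ (s τ i).count (.finishRbc i)) :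
    ∃ τ, Msg.election ∈ (s τ i).sent := by
  have ht : ∀ τ, (s τ i).terminated = false := fun τ => hx.not_terminated hi (hr τ)
  refine hx.reach hi .election (P := fun x => Msg.election ∈ x.sent) ?_
  filter_upwards [hc] with τ h1
  by_cases h : Msg.election ∈ (s τ i).sent
  · exact Or.inl h
  · right
    simp only [fire, ht, hr, h1, h, NodeState.send]
    simp

/-- No assumption on the return is needed for CONFIRM: a node that has stopped the dispersal has
sent it on stopping. -/
theorem exists_confirm_of_election (hx : IsExecution ec H w s ev) {i : Fin n} (hi : i ∈ H)
    (hc : ∀ᶠ τ in atTop, n - t ≤ (s τ i).count .election) :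
    ∃ τ, Msg.confirm ∈ (s τ i).sent := by
  refine hx.reach hi .confirmElection (P := fun x => Msg.confirm ∈ x.sent) ?_
  filter_upwards [hc] with τ h1
  by_cases h : Msg.confirm ∈ (s τ i).sent
  · exact Or.inl h
  · right
    have hr : (s τ i).returned = false := by
      by_contra hne
      exact h ((hx.localInv hi τ).returned (by simpa using hne)).1
    have ht := hx.not_terminated hi hr
    simp only [fire, ht, hr, h1, h, NodeState.send]
    simp

theorem exists_confirm_of_confirm (hx : IsExecution ec H w s ev) {i : Fin n} (hi : i ∈ H)
    (hc : ∀ᶠ τ in atTop, t + 1 ≤ (s τ i).count .confirm) :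
    ∃ τ, Msg.confirm ∈ (s τ i).sent := by
  refine hx.reach hi .confirmAmplify (P := fun x => Msg.confirm ∈ x.sent) ?_
  filter_upwards [hc] with τ h1
  by_cases h : Msg.confirm ∈ (s τ i).sent
  · exact Or.inl h
  · right
    have hr : (s τ i).returned = false := by
      by_contra hne
      exact h ((hx.localInv hi τ).returned (by simpa using hne)).1
    have ht := hx.not_terminated hi hr
    simp only [fire, ht, hr, h1, h, NodeState.send]
    simp

theorem exists_returned_of_confirm (hx : IsExecution ec H w s ev) {i : Fin n} (hi : i ∈ H)
    (hc : ∀ᶠ τ in atTop, 2 * t + 1 ≤ (s τ i).count .confirm) :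
    ∃ τ, (s τ i).returned = true := by
  refine hx.reach hi .acidReturn (P := fun x => x.returned = true) ?_
  filter_upwards [hc] with τ h1
  by_cases hr : (s τ i).returned = true
  · exact Or.inl hr
  · right
    have ht : (s τ i).terminated = false := by
      by_contra hne
      exact hr (hx.terminated_returned hi (by simpa using hne))
    simp only [fire, ht, hr, h1, NodeState.send]
    simp

theorem exists_symIn (hx : IsExecution ec H w s ev) {i : Fin n} (hi : i ∈ H)
    (hr : ∀ τ, (s τ i).returned = false) :
    ∃ τ, (s τ i).syms.isSome ∧ (s τ i).symIn.isSome := by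
  obtain ⟨τ, hτ⟩ := hx.input i hi
  have h := hx.step i hi τ _ hτ
  -- A terminated node ignores its input, so termination before the input event has to be excluded.
  have ht := hx.not_terminated hi (hr τ)
  simp only [Event.apply, ht, Bool.false_eq_true, if_false, Option.some.injEq] at h
  exact ⟨τ + 1, by simp [← h]⟩

/-- The honest leader `j` gets its symbol to every honest node, so each of them votes on position
`j`; a bit with `t + 1` honest votes then drives READY and FINISH at all honest nodes. -/
theorem exists_C_of_not_returned (hnt : 3 * t + 1 ≤ n) (hH : Hᶜ.ncard ≤ t)
    (hx : IsExecution ec H w s ev) (hr : ∀ i ∈ H, ∀ τ, (s τ i).returned = false)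
    {i j : Fin n} (hi : i ∈ H) (hj : j ∈ H) : ∃ τ, ((s τ i).C j).isSome := by
  have hin : ∀ p ∈ H, ∃ b, ∃ τ, (s τ p).apvaIn j = some b := by
    intro p hp
    obtain ⟨τ, -, h1⟩ := hx.exists_symIn hj (hr j hj)
    obtain ⟨y, h1⟩ := Option.isSome_iff_exists.1 h1
    obtain ⟨τ₁, h1⟩ := (hx.rbcSym j).validity hj τ y h1 p hp
    obtain ⟨τ₂, h2, -⟩ := hx.exists_symIn hp (hr p hp)
    obtain ⟨τ₃, h3⟩ := hx.exists_apvaIn hp (hr p hp) (j := j) ⟨τ₂, h2⟩ ⟨τ₁, by simp [h1]⟩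
    obtain ⟨b, h3⟩ := Option.isSome_iff_exists.1 h3
    exact ⟨b, τ₃, h3⟩
  choose! b hb using hin
  obtain ⟨S, hS, hS'⟩ := exists_honest_finset hH
  -- At least `n - t ≥ 2t + 1` honest nodes vote for one of two bits.
  have hmaj : ∃ c, t + 1 ≤ (S.filter fun p => b p = c).card := by
    have h1 := Finset.card_filter_add_card_filter_not (s := S) (fun p => b p = true)
    simp only [Bool.not_eq_true] at h1
    by_cases h2 : t + 1 ≤ (S.filter fun p => b p = true).card
    · exact ⟨true, h2⟩
    · exact ⟨false, by omega⟩
  obtain ⟨c, hc⟩ := hmaj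
  have hready : ∀ p ∈ H, ∃ τ, Msg.ready j c ∈ (s τ p).sent := by
    intro p hp
    refine hx.exists_ready hp (hr p hp) ?_
    have hev := hx.eventually_forall_rcvd hp (m := .vote j c)
      (S := S.filter fun p => b p = c) fun q hq => by
        rw [Finset.mem_filter] at hq
        have hq' := (hS' q).1 hq.1
        exact ⟨hq', hx.exists_vote hq' (hr q hq') (hq.2 ▸ hb q hq')⟩
    filter_upwards [hev] with τ hτ
    exact hc.trans hτ
  have hfin : ∀ p ∈ H, ∃ τ, Msg.finish j c ∈ (s τ p).sent := fun p hp =>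
    hx.exists_finish hp (hr p hp) (hx.eventually_count hH hp hready)
  exact hx.exists_C hi (hr i hi) (hx.eventually_count hH hi hfin)

theorem exists_vecIn_of_not_returned (hnt : 3 * t + 1 ≤ n) (hH : Hᶜ.ncard ≤ t)
    (hx : IsExecution ec H w s ev) (hr : ∀ i ∈ H, ∀ τ, (s τ i).returned = false)
    {i : Fin n} (hi : i ∈ H) : ∃ τ, ((s τ i).vecIn).isSome := by
  obtain ⟨S, hS, hS'⟩ := exists_honest_finset hH
  have : ∀ᶠ τ in atTop, ∀ j ∈ S, ((s τ i).C j).isSome := by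
    rw [eventually_all_finset]
    intro j hj
    obtain ⟨τ, hτ⟩ := hx.exists_C_of_not_returned hnt hH hr hi ((hS' j).1 hj)
    exact hx.eventually_of_mono hi (P := fun x => (x.C j).isSome)
      (fun x y h => Option.isSome_mono (h.C j)) hτ
  obtain ⟨τ, hτ⟩ := this.exists
  refine ⟨τ, (hx.localInv hi τ).vecIn_isSome (by omega) ?_⟩
  rw [(hx.localInv hi τ).cnt]
  exact hS.trans (Finset.card_le_card fun j hj => by simpa [nonMissing] using hτ j hj)

/-- Only one return can be obtained by contradiction: a node that returns stops helping, so the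
others are handled separately through CONFIRM. -/
theorem exists_honest_returned (hnt : 3 * t + 1 ≤ n) (hH : Hᶜ.ncard ≤ t)
    (hx : IsExecution ec H w s ev) : ∃ i ∈ H, ∃ τ, (s τ i).returned = true := by
  by_contra! hr
  simp only [ne_eq, Bool.not_eq_true] at hr
  have hvec : ∀ j ∈ H, ∀ i ∈ H, ∃ τ, ((s τ i).vecOut j).isSome := by
    intro j hj i hi
    obtain ⟨τ, hτ⟩ := hx.exists_vecIn_of_not_returned hnt hH hr hj
    obtain ⟨v, hτ⟩ := Option.isSome_iff_exists.1 hτ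
    obtain ⟨τ', hτ'⟩ := (hx.rbcVec j).validity hj τ v hτ i hi
    exact ⟨τ', by simp [hτ']⟩
  have hready : ∀ j ∈ H, ∀ i ∈ H, ∃ τ, Msg.readyRbc j ∈ (s τ i).sent := fun j hj i hi =>
    hx.exists_readyRbc hi (hr i hi) (hvec j hj i hi)
  have hfin : ∀ j ∈ H, ∀ i ∈ H, ∃ τ, Msg.finishRbc j ∈ (s τ i).sent := fun j hj i hi =>
    hx.exists_finishRbc hi (hr i hi) (hx.eventually_count hH hi (hready j hj))
  have hel : ∀ i ∈ H, ∃ τ, Msg.election ∈ (s τ i).sent := fun i hi =>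
    hx.exists_election hi (hr i hi) (hx.eventually_count hH hi (hfin i hi))
  have hconf : ∀ i ∈ H, ∃ τ, Msg.confirm ∈ (s τ i).sent := fun i hi =>
    hx.exists_confirm_of_election hi (hx.eventually_count hH hi hel)
  obtain ⟨S, hS, hS'⟩ := exists_honest_finset hH
  obtain ⟨i, hi⟩ := Finset.card_pos.1 (show 0 < S.card by omega)
  have hi := (hS' i).1 hi
  obtain ⟨τ, hτ⟩ := hx.exists_returned_of_confirm hi (by
    filter_upwards [hx.eventually_count hH hi hconf] with τ hτ
    omega)
  simp [hr i hi τ] at hτ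

/-- Of the `2t + 1` CONFIRM messages seen by the returning node, `t + 1` are honest and reach
everyone; amplification then yields `n - t ≥ 2t + 1` of them at each honest node. -/
theorem exists_returned (hnt : 3 * t + 1 ≤ n) (hH : Hᶜ.ncard ≤ t)
    (hx : IsExecution ec H w s ev) {i : Fin n} (hi : i ∈ H) : ∃ τ, (s τ i).returned = true := by
  obtain ⟨p, hp, τ, hτ⟩ := hx.exists_honest_returned hnt hH
  classical
  have h1 := ((hx.localInv hp τ).returned hτ).2
  have h2 := card_filter_le_honest (P := fun q => (q, Msg.confirm) ∈ (s τ p).rcvd) hH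
  have hconf : ∀ i ∈ H, ∃ τ, Msg.confirm ∈ (s τ i).sent := by
    intro i hi
    refine hx.exists_confirm_of_confirm hi ?_
    have hev := hx.eventually_forall_rcvd hi (m := .confirm)
      (S := Finset.univ.filter fun q => q ∈ H ∧ (q, Msg.confirm) ∈ (s τ p).rcvd) fun q hq => by
        simp only [Finset.mem_filter, Finset.mem_univ, true_and] at hq
        exact ⟨hq.1, τ, hx.sent_of_rcvd' hp hq.1 hq.2⟩
    filter_upwards [hev] with τ' hτ'
    refine le_trans ?_ hτ'
    have : (s τ p).count .confirm =
        (Finset.univ.filter fun q => (q, Msg.confirm) ∈ (s τ p).rcvd).card := by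
      unfold NodeState.count; congr
    omega
  refine hx.exists_returned_of_confirm hi ?_
  filter_upwards [hx.eventually_count hH hi hconf] with τ hτ
  omega

end IsExecution

/-- The honest node `l` is a good leader: `t + 1` honest nodes have set its finish indicator. -/
structure GoodLeader (H : Set (Fin n)) (s : ℕ → Fin n → NodeState n t A) (l : Fin n) : Prop where
  honest : l ∈ H
  rbcF : ∃ S : Finset (Fin n), t + 1 ≤ S.card ∧ ∀ q ∈ S, q ∈ H ∧ ∃ τ, (s τ q).rbcF l = true

namespace IsExecution

variable {ec : ErasureCode n (t + 1) A} {H : Set (Fin n)} {w : Fin n → Fin (t + 1) → A}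
  {s : ℕ → Fin n → NodeState n t A} {ev : ℕ → Option (Fin n × Event n A)}

/-! ## Origins of messages -/

theorem exists_sent_of_count (hH : Hᶜ.ncard ≤ t) (hx : IsExecution ec H w s ev) {i : Fin n}
    (hi : i ∈ H) {m : Msg n} {τ : ℕ} (h : t + 1 ≤ (s τ i).count m) :
    ∃ p ∈ H, ∃ τ' < τ, m ∈ (s τ' p).sent := by
  obtain ⟨p, hp, h⟩ := exists_honest hH h
  exact ⟨p, hp, hx.sent_of_rcvd hi hp h⟩

theorem exists_finset_sent_of_count (hH : Hᶜ.ncard ≤ t) (hx : IsExecution ec H w s ev)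
    {i : Fin n} (hi : i ∈ H) {m : Msg n} {τ : ℕ} (h : n - t ≤ (s τ i).count m) :
    ∃ S : Finset (Fin n), n - 2 * t ≤ S.card ∧ ∀ p ∈ S, p ∈ H ∧ m ∈ (s τ p).sent := by
  obtain ⟨S, hS, h⟩ := exists_finset_honest hH h
  exact ⟨S, hS, fun p hp => ⟨(h p hp).1, hx.sent_of_rcvd' hi (h p hp).1 (h p hp).2⟩⟩

/-- Descent on time: a CONFIRM sent by amplification has an earlier honest CONFIRM behind it, so
some honest one was triggered by ELECTION messages. -/
theorem exists_election_count (hH : Hᶜ.ncard ≤ t) (hx : IsExecution ec H w s ev) (τ : ℕ) :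
    ∀ i ∈ H, Msg.confirm ∈ (s τ i).sent → ∃ p ∈ H, ∃ τ', n - t ≤ (s τ' p).count .election := by
  induction τ using Nat.strong_induction_on with
  | _ τ ih =>
    intro i hi h
    rcases (hx.localInv hi τ).confirm h with h | h
    · exact ⟨i, hi, τ, h⟩
    · obtain ⟨p, hp, τ', h1, h2⟩ := hx.exists_sent_of_count hH hi h
      exact ih τ' h1 p hp h2

theorem exists_symOut_of_vote (hH : Hᶜ.ncard ≤ t) (hx : IsExecution ec H w s ev) {j : Fin n}
    {b : Bool} (τ : ℕ) :
    ∀ i ∈ H, Msg.vote j b ∈ (s τ i).sent → ∃ p ∈ H, ∃ τ', ((s τ' p).symOut j).isSome := by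
  induction τ using Nat.strong_induction_on with
  | _ τ ih =>
    intro i hi h
    rcases (hx.localInv hi τ).vote j b h with h | h
    · exact ⟨i, hi, τ, (hx.localInv hi τ).apvaIn j (by simp [h])⟩
    · obtain ⟨p, hp, τ', h1, h2⟩ := hx.exists_sent_of_count hH hi h
      exact ih τ' h1 p hp h2

theorem exists_symOut_of_R (hH : Hᶜ.ncard ≤ t) (hx : IsExecution ec H w s ev) {i j : Fin n}
    {b : Bool} {τ : ℕ} (hi : i ∈ H) (h : (s τ i).R b j = true) :
    ∃ p ∈ H, ∃ τ', ((s τ' p).symOut j).isSome := by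
  obtain ⟨p, hp, τ', -, h⟩ := hx.exists_sent_of_count hH hi ((hx.localInv hi τ).R j b h)
  exact hx.exists_symOut_of_vote hH τ' p hp h

theorem exists_R_of_F (hH : Hᶜ.ncard ≤ t) (hx : IsExecution ec H w s ev)
    {i j : Fin n} {b : Bool} {τ : ℕ} (hi : i ∈ H) (h : (s τ i).F b j = true) :
    ∃ S : Finset (Fin n), n - 2 * t ≤ S.card ∧ ∀ p ∈ S, p ∈ H ∧ (s τ p).R b j = true := by
  obtain ⟨S, hS, h⟩ := hx.exists_finset_sent_of_count hH hi ((hx.localInv hi τ).F j b h)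
  exact ⟨S, hS, fun p hp => ⟨(h p hp).1, ((hx.localInv (h p hp).1 τ).ready j b).1 (h p hp).2⟩⟩

theorem exists_F_of_C (hH : Hᶜ.ncard ≤ t) (hx : IsExecution ec H w s ev)
    {i j : Fin n} {b : Bool} {τ : ℕ} (hi : i ∈ H) (h : (s τ i).C j = some b) :
    ∃ S : Finset (Fin n), n - 2 * t ≤ S.card ∧ ∀ p ∈ S, p ∈ H ∧ (s τ p).F b j = true := by
  obtain ⟨S, hS, h⟩ := hx.exists_finset_sent_of_count hH hi ((hx.localInv hi τ).C j b h)
  exact ⟨S, hS, fun p hp => ⟨(h p hp).1, ((hx.localInv (h p hp).1 τ).finish j b).1 (h p hp).2⟩⟩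

theorem exists_rbcR_of_rbcF (hH : Hᶜ.ncard ≤ t) (hx : IsExecution ec H w s ev)
    {i j : Fin n} {τ : ℕ} (hi : i ∈ H) (h : (s τ i).rbcF j = true) :
    ∃ S : Finset (Fin n), n - 2 * t ≤ S.card ∧ ∀ p ∈ S, p ∈ H ∧ (s τ p).rbcR j = true := by
  obtain ⟨S, hS, h⟩ := hx.exists_finset_sent_of_count hH hi ((hx.localInv hi τ).rbcF j h)
  exact ⟨S, hS, fun p hp => ⟨(h p hp).1, ((hx.localInv (h p hp).1 τ).readyRbc j).1 (h p hp).2⟩⟩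

/-- Behind a return are `n - t` ELECTION messages, and each honest one of them rests on `n - t`
messages FINISH' for its sender, of which at least `n - 2t ≥ t + 1` are honest. -/
theorem exists_goodLeaders (hnt : 3 * t + 1 ≤ n) (hH : Hᶜ.ncard ≤ t)
    (hx : IsExecution ec H w s ev) :
    ∃ S : Finset (Fin n), n - 2 * t ≤ S.card ∧ ∀ l ∈ S, GoodLeader H s l := by
  obtain ⟨i, hi, τ, h⟩ := hx.exists_honest_returned hnt hH
  obtain ⟨p, hp, τ', h⟩ := hx.exists_election_count hH τ i hi ((hx.localInv hi τ).returned h).1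
  obtain ⟨S, hS, h⟩ := hx.exists_finset_sent_of_count hH hp h
  refine ⟨S, hS, fun l hl => ⟨(h l hl).1, ?_⟩⟩
  obtain ⟨hl, h⟩ := h l hl
  obtain ⟨S', hS', h⟩ :=
    hx.exists_finset_sent_of_count hH hl ((hx.localInv hl τ').election h)
  exact ⟨S', by omega, fun q hq => ⟨(h q hq).1, τ',
    ((hx.localInv (h q hq).1 τ').finishRbc l).1 (h q hq).2⟩⟩

/-! ## Biased agreement -/

theorem biasedIn_unique (hx : IsExecution ec H w s ev) {i : Fin n} (hi : i ∈ H) {k : BiasedId n}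
    {τ τ' : ℕ} {a a' : Bool × Bool} (h : (s τ i).biasedIn k = some a)
    (h' : (s τ' i).biasedIn k = some a') : a = a' := by
  have h1 := (hx.mono hi (le_max_left τ τ')).biasedIn _ _ h
  have h2 := (hx.mono hi (le_max_right τ τ')).biasedIn _ _ h'
  rw [h1] at h2
  exact Option.some.inj h2

theorem biasedIn_of_rcvd (hx : IsExecution ec H w s ev) {i p : Fin n} (hi : i ∈ H) (hp : p ∈ H)
    {k : BiasedId n} {τ : ℕ} {a₁ a₂ : Bool} (h : (p, Msg.value k a₁ a₂) ∈ (s τ i).rcvd) :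
    (s τ p).biasedIn k = some (a₁, a₂) :=
  ((hx.localInv hp τ).value k a₁ a₂).1 (hx.sent_of_rcvd' hi hp h)

/-- By `hspread`, one honest second bit `1` brings `t + 1` honest first bits `1`. Without any such
bit, all `n - t` honest values count towards the threshold for `0`. -/
theorem biasedOut_terminates (hH : Hᶜ.ncard ≤ t)
    (hx : IsExecution ec H w s ev) {i : Fin n} (hi : i ∈ H) (k : BiasedId n)
    (ht : ∀ᶠ τ in atTop, (s τ i).terminated = false)
    (hin : ∀ q ∈ H, ∃ τ, ((s τ q).biasedIn k).isSome)
    (hspread : ∀ q ∈ H, ∀ τ a₁, (s τ q).biasedIn k = some (a₁, true) →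
      ∃ S : Finset (Fin n), t + 1 ≤ S.card ∧ ∀ p ∈ S, p ∈ H ∧
        ∀ τ b₁ b₂, (s τ p).biasedIn k = some (b₁, b₂) → b₁ = true) :
    ∃ τ, ((s τ i).biasedOut k).isSome := by
  have hval : ∀ q ∈ H, ∃ a₁ a₂ τ, (s τ q).biasedIn k = some (a₁, a₂) := by
    intro q hq
    obtain ⟨τ, h⟩ := hin q hq
    obtain ⟨⟨a₁, a₂⟩, h⟩ := Option.isSome_iff_exists.1 h
    exact ⟨a₁, a₂, τ, h⟩
  have hsent : ∀ q ∈ H, ∀ τ a₁ a₂, (s τ q).biasedIn k = some (a₁, a₂) →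
      ∀ᶠ τ' in atTop, (q, Msg.value k a₁ a₂) ∈ (s τ' i).rcvd := fun q hq τ a₁ a₂ h =>
    hx.eventually_rcvd hi hq (((hx.localInv hq τ).value k a₁ a₂).2 h)
  have hcount : ∀ᶠ τ in atTop, t + 1 ≤ (s τ i).cntFst k ∨ n - t ≤ (s τ i).cntZero k := by
    by_cases hex : ∃ q ∈ H, ∃ τ a₁, (s τ q).biasedIn k = some (a₁, true)
    · obtain ⟨q, hq, τ, a₁, h⟩ := hex
      obtain ⟨S, hS, h⟩ := hspread q hq τ a₁ h
      have : ∀ᶠ τ in atTop, ∀ p ∈ S, ∃ a₂, (p, Msg.value k true a₂) ∈ (s τ i).rcvd := by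
        rw [eventually_all_finset]
        intro p hp
        obtain ⟨hpH, h⟩ := h p hp
        obtain ⟨b₁, b₂, τ', h'⟩ := hval p hpH
        have := h τ' b₁ b₂ h'
        subst this
        filter_upwards [hsent p hpH τ' _ _ h'] with τ hτ
        exact ⟨b₂, hτ⟩
      filter_upwards [this] with τ hτ
      exact Or.inl (hS.trans (Finset.card_le_card fun p hp => by simpa using hτ p hp))
    · push Not at hex
      obtain ⟨S, hS, hS'⟩ := exists_honest_finset hH
      have : ∀ᶠ τ in atTop, ∀ p ∈ S, ∃ a₁, (p, Msg.value k a₁ false) ∈ (s τ i).rcvd := by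
        rw [eventually_all_finset]
        intro p hp
        have hpH := (hS' p).1 hp
        obtain ⟨b₁, b₂, τ', h'⟩ := hval p hpH
        cases b₂
        · filter_upwards [hsent p hpH τ' _ _ h'] with τ hτ
          exact ⟨b₁, hτ⟩
        · exact absurd h' (hex p hpH τ' b₁)
      filter_upwards [this] with τ hτ
      exact Or.inr (hS.trans (Finset.card_le_card fun p hp => by simpa using hτ p hp))
  obtain ⟨τ₀, hτ₀⟩ := hin i hi
  refine hx.reach hi (.biasedOut k) (P := fun x => (x.biasedOut k).isSome) ?_
  filter_upwards [hcount, ht, hx.eventually_of_mono hi (P := fun x => (x.biasedIn k).isSome)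
    (fun x y h => Option.isSome_mono (h.biasedIn k)) hτ₀] with τ h1 h2 h3
  by_cases h : (s τ i).biasedOut k = none
  · right
    simp only [fire, h2, h, h3, Bool.false_eq_true, if_false, and_self, if_true]
    split_ifs with h4 h5
    · simp
    · simp
    · omega
  · left; exact Option.isSome_iff_ne_none.2 h

theorem exists_biasedIn_of_biasedOut_true (hH : Hᶜ.ncard ≤ t) (hx : IsExecution ec H w s ev)
    {i : Fin n} (hi : i ∈ H) {k : BiasedId n} {τ : ℕ} (h : (s τ i).biasedOut k = some true) :
    ∃ q ∈ H, ∃ a₁ a₂, (s τ q).biasedIn k = some (a₁, a₂) ∧ (a₁ = true ∨ a₂ = true) := by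
  rcases (hx.localInv hi τ).biasedOut_true k h with ⟨a₁, a₂, h⟩ | h | h
  · exact ⟨i, hi, a₁, a₂, h⟩
  · obtain ⟨p, hp, a₂, h⟩ := exists_honest hH h
    exact ⟨p, hp, true, a₂, hx.biasedIn_of_rcvd hi hp h, Or.inl rfl⟩
  · obtain ⟨p, hp, a₁, h⟩ := exists_honest hH h
    exact ⟨p, hp, a₁, true, hx.biasedIn_of_rcvd hi hp h, Or.inr rfl⟩

/-- An answer `0` needs `n - t` senders with second bit `0`. These are disjoint from `S`, whose
members have a unique input with second bit `1`, and `(n - t) + (t + 1) > n`. -/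
theorem biasedOut_ne_false (hnt : 3 * t + 1 ≤ n) (hx : IsExecution ec H w s ev)
    {i : Fin n} (hi : i ∈ H) {k : BiasedId n} {S : Finset (Fin n)} (hS : t + 1 ≤ S.card)
    (hS' : ∀ q ∈ S, q ∈ H ∧ ∃ τ a₁, (s τ q).biasedIn k = some (a₁, true)) (τ : ℕ) :
    (s τ i).biasedOut k ≠ some false := by
  classical
  intro h
  have h1 := (hx.localInv hi τ).biasedOut_false k h
  have h2 : Disjoint S (Finset.univ.filter fun p =>
      ∃ a₁, (p, Msg.value k a₁ false) ∈ (s τ i).rcvd) := by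
    rw [Finset.disjoint_left]
    intro q hq hq'
    simp only [Finset.mem_filter, Finset.mem_univ, true_and] at hq'
    obtain ⟨b₁, hb⟩ := hq'
    obtain ⟨hqH, τ', a₁, ha⟩ := hS' q hq
    have := hx.biasedIn_unique hqH (hx.biasedIn_of_rcvd hi hqH hb) ha
    simp at this
  have h3 := Finset.card_le_univ (S ∪ Finset.univ.filter fun p =>
      ∃ a₁, (p, Msg.value k a₁ false) ∈ (s τ i).rcvd)
  rw [Finset.card_union_of_disjoint h2, Fintype.card_fin] at h3
  have h4 : (s τ i).cntZero k = (Finset.univ.filter fun p =>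
      ∃ a₁, (p, Msg.value k a₁ false) ∈ (s τ i).rcvd).card := by
    unfold NodeState.cntZero; congr
  omega

/-- The times are unrelated: bits only increase until the return and are then frozen, and the input
is read after the return. -/
theorem main_input (hx : IsExecution ec H w s ev) {i l : Fin n} (hi : i ∈ H) {τ τ' : ℕ}
    {a₁ a₂ : Bool} (h : (s τ i).biasedIn (.main l) = some (a₁, a₂)) :
    ((s τ' i).rbcR l = true → a₁ = true) ∧ ((s τ' i).rbcF l = true → a₂ = true) := by
  obtain ⟨h1, rfl, rfl⟩ := (hx.localInv hi τ).biasedIn_main l a₁ a₂ h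
  rcases le_total τ τ' with h2 | h2
  · obtain ⟨-, -, e1, e2⟩ := (hx.mono hi h2).frozen h1
    rw [e1, e2]; simp
  · exact ⟨(hx.mono hi h2).rbcR l, (hx.mono hi h2).rbcF l⟩

theorem vecOut_unique (hx : IsExecution ec H w s ev) {i i' l : Fin n} (hi : i ∈ H) (hi' : i' ∈ H)
    {τ τ' : ℕ} {v v' : PVec n} (h : (s τ i).vecOut l = some v)
    (h' : (s τ' i').vecOut l = some v') : v = v' :=
  (hx.rbcVec l).consistency i hi i' hi' τ τ' v v' h h'

/-- Consistency of the broadcast of `l` makes every honest node read the indicators for the same bit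
`b`, so inputs of different nodes are comparable. -/
theorem entry_input (hx : IsExecution ec H w s ev) {i p l j : Fin n} (hi : i ∈ H) (hp : p ∈ H)
    {τ τ' τ₁ : ℕ} {v : PVec n} {b a₁ a₂ : Bool} (hv : (s τ₁ p).vecOut l = some v)
    (hb : v j = some b) (h : (s τ i).biasedIn (.entry l j) = some (a₁, a₂)) :
    ((s τ i).R b j = a₁ ∧ (s τ i).F b j = a₂) ∧
      ((s τ' i).R b j = true → a₁ = true) ∧ ((s τ' i).F b j = true → a₂ = true) := by
  obtain ⟨h1, v', b', h2, h3, rfl, rfl⟩ := (hx.localInv hi τ).biasedIn_entry l j a₁ a₂ h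
  have := hx.vecOut_unique hi hp h2 hv
  subst this
  rw [hb, Option.some.injEq] at h3
  subst h3
  refine ⟨⟨rfl, rfl⟩, ?_⟩
  rcases le_total τ τ' with h2 | h2
  · obtain ⟨e1, e2, -, -⟩ := (hx.mono hi h2).frozen h1
    rw [e1, e2]; simp
  · exact ⟨(hx.mono hi h2).R b j, (hx.mono hi h2).F b j⟩

theorem main_terminates (hnt : 3 * t + 1 ≤ n) (hH : Hᶜ.ncard ≤ t)
    (hx : IsExecution ec H w s ev) {i : Fin n} (hi : i ∈ H) (l : Fin n)
    (ht : ∀ᶠ τ in atTop, (s τ i).terminated = false)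
    (hin : ∀ q ∈ H, ∃ τ, ((s τ q).biasedIn (.main l)).isSome) :
    ∃ τ, ((s τ i).biasedOut (.main l)).isSome := by
  refine hx.biasedOut_terminates hH hi _ ht hin fun q hq τ a₁ h => ?_
  obtain ⟨S, hS, h⟩ := hx.exists_rbcR_of_rbcF hH hq
    ((hx.localInv hq τ).biasedIn_main l _ _ h).2.2.symm
  exact ⟨S, by omega, fun p hp => ⟨(h p hp).1, fun τ' b₁ b₂ h' =>
    (hx.main_input (h p hp).1 h').1 (h p hp).2⟩⟩

theorem exists_vecOut_of_main_true (hnt : 3 * t + 1 ≤ n) (hH : Hᶜ.ncard ≤ t)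
    (hx : IsExecution ec H w s ev) {i l : Fin n} (hi : i ∈ H) {τ : ℕ}
    (h : (s τ i).biasedOut (.main l) = some true) :
    ∃ p ∈ H, ∃ τ', ((s τ' p).vecOut l).isSome := by
  obtain ⟨q, hq, a₁, a₂, h1, h2⟩ := hx.exists_biasedIn_of_biasedOut_true hH hi h
  obtain ⟨-, rfl, rfl⟩ := (hx.localInv hq τ).biasedIn_main l _ _ h1
  rcases h2 with h2 | h2
  · exact ⟨q, hq, τ, (hx.localInv hq τ).rbcR l h2⟩
  · obtain ⟨S, hS, h⟩ := hx.exists_rbcR_of_rbcF hH hq h2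
    obtain ⟨p, hp⟩ := Finset.card_pos.1 (show 0 < S.card by omega)
    exact ⟨p, (h p hp).1, τ, (hx.localInv (h p hp).1 τ).rbcR l (h p hp).2⟩

theorem main_ne_false (hnt : 3 * t + 1 ≤ n) (hx : IsExecution ec H w s ev) {i l : Fin n}
    (hi : i ∈ H) (hl : GoodLeader H s l)
    (hin : ∀ q ∈ H, ∃ τ, ((s τ q).biasedIn (.main l)).isSome) (τ : ℕ) :
    (s τ i).biasedOut (.main l) ≠ some false := by
  obtain ⟨S, hS, h⟩ := hl.rbcF
  refine hx.biasedOut_ne_false hnt hi hS (fun q hq => ⟨(h q hq).1, ?_⟩) τ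
  obtain ⟨hqH, τ₁, h1⟩ := h q hq
  obtain ⟨τ₂, h2⟩ := hin q hqH
  obtain ⟨⟨a₁, a₂⟩, h2⟩ := Option.isSome_iff_exists.1 h2
  have := (hx.main_input hqH h2).2 h1
  subst this
  exact ⟨τ₂, a₁, h2⟩

theorem entry_terminates (hnt : 3 * t + 1 ≤ n) (hH : Hᶜ.ncard ≤ t)
    (hx : IsExecution ec H w s ev) {i p l j : Fin n} (hi : i ∈ H) (hp : p ∈ H)
    {v : PVec n} {τ : ℕ} (hv : (s τ p).vecOut l = some v) (hj : j ∈ nonMissing v)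
    (ht : ∀ᶠ τ in atTop, (s τ i).terminated = false)
    (hin : ∀ q ∈ H, ∃ τ, ((s τ q).biasedIn (.entry l j)).isSome) :
    ∃ τ, ((s τ i).biasedOut (.entry l j)).isSome := by
  obtain ⟨b, hb⟩ := Option.isSome_iff_exists.1 (by simpa [nonMissing] using hj)
  refine hx.biasedOut_terminates hH hi _ ht hin fun q hq τ a₁ h => ?_
  obtain ⟨S, hS, h⟩ := hx.exists_R_of_F hH hq
    -- Only the equalities at the time `τ` are used here, so `τ'` is arbitrary.
    (hx.entry_input (τ' := 0) hq hp hv hb h).1.2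
  exact ⟨S, by omega, fun p' hp' => ⟨(h p' hp').1, fun τ' b₁ b₂ h' =>
    (hx.entry_input (h p' hp').1 hp hv hb h').2.1 (h p' hp').2⟩⟩

theorem exists_symOut_of_entry_true (hnt : 3 * t + 1 ≤ n) (hH : Hᶜ.ncard ≤ t)
    (hx : IsExecution ec H w s ev) {i l j : Fin n} (hi : i ∈ H) {τ : ℕ}
    (h : (s τ i).biasedOut (.entry l j) = some true) :
    ∃ p ∈ H, ∃ τ', ((s τ' p).symOut j).isSome := by
  obtain ⟨q, hq, a₁, a₂, h1, h2⟩ := hx.exists_biasedIn_of_biasedOut_true hH hi h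
  obtain ⟨-, v, b, -, -, rfl, rfl⟩ := (hx.localInv hq τ).biasedIn_entry l j _ _ h1
  rcases h2 with h2 | h2
  · exact hx.exists_symOut_of_R hH hq h2
  · obtain ⟨S, hS, h⟩ := hx.exists_R_of_F hH hq h2
    obtain ⟨p, hp⟩ := Finset.card_pos.1 (show 0 < S.card by omega)
    exact hx.exists_symOut_of_R hH (h p hp).1 (h p hp).2

/-- Causality is what identifies a delivered vector with the snapshot already taken by the leader.
-/
theorem vecOut_of_honest (hx : IsExecution ec H w s ev) {p l : Fin n} (hp : p ∈ H)
    (hl : l ∈ H) {v : PVec n} {τ : ℕ} (hv : (s τ p).vecOut l = some v) :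
    (nonMissing v).card = n - t ∧ ∀ j b, v j = some b → (s τ l).C j = some b :=
  (hx.localInv hl τ).vecIn v ((hx.rbcVec l).causality hl p hp τ v hv)

/-- An honest leader confirmed each entry on `n - t` FINISH messages, so at least `t + 1` honest
nodes have the corresponding finish bit and feed it in as second bit. -/
theorem entry_ne_false (hnt : 3 * t + 1 ≤ n) (hH : Hᶜ.ncard ≤ t)
    (hx : IsExecution ec H w s ev) {i p l j : Fin n} (hi : i ∈ H) (hp : p ∈ H) (hl : l ∈ H)
    {v : PVec n} {τ : ℕ} (hv : (s τ p).vecOut l = some v) (hj : j ∈ nonMissing v)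
    (hin : ∀ q ∈ H, ∃ τ, ((s τ q).biasedIn (.entry l j)).isSome) (τ' : ℕ) :
    (s τ' i).biasedOut (.entry l j) ≠ some false := by
  obtain ⟨b, hb⟩ := Option.isSome_iff_exists.1 (by simpa [nonMissing] using hj)
  obtain ⟨S, hS, h⟩ := hx.exists_F_of_C hH hl ((hx.vecOut_of_honest hp hl hv).2 j b hb)
  refine hx.biasedOut_ne_false hnt hi (show t + 1 ≤ S.card by omega)
    (fun q hq => ⟨(h q hq).1, ?_⟩) τ'
  obtain ⟨hqH, h1⟩ := h q hq
  obtain ⟨τ₂, h2⟩ := hin q hqH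
  obtain ⟨⟨a₁, a₂⟩, h2⟩ := Option.isSome_iff_exists.1 h2
  have := (hx.entry_input hqH hp hv hb h2).2.2 h1
  subst this
  exact ⟨τ₂, a₁, h2⟩

end IsExecution

/-! ## The rounds of vector agreement -/

/-- The control point after round `r`. -/
def nextPc (r : Fin n) : Pc n :=
  if h : r.val + 1 < n then .electing ⟨r.val + 1, h⟩ else .exhausted

theorem NodeState.nextRound_pc (s : NodeState n t A) (r : Fin n) :
    (s.nextRound r).pc = nextPc r := by
  unfold NodeState.nextRound nextPc
  split_ifs <;> rfl

/-- Every honest node gets to the control point `X`. -/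
def AllReach (H : Set (Fin n)) (s : ℕ → Fin n → NodeState n t A) (X : Pc n) : Prop :=
  ∀ i ∈ H, ∃ τ, (s τ i).pc = X

namespace IsExecution

variable {ec : ErasureCode n (t + 1) A} {H : Set (Fin n)} {w : Fin n → Fin (t + 1) → A}
  {s : ℕ → Fin n → NodeState n t A} {ev : ℕ → Option (Fin n × Event n A)}

theorem exists_honest_node (hnt : 3 * t + 1 ≤ n) (hH : Hᶜ.ncard ≤ t) : ∃ i, i ∈ H := by
  obtain ⟨S, hS, h⟩ := exists_honest_finset hH
  obtain ⟨i, hi⟩ := Finset.card_pos.1 (show 0 < S.card by omega)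
  exact ⟨i, (h i).1 hi⟩

/-- Nodes may reach `X` at different times; the reasons that end the wait are persistent. A node
stuck at `X` has not terminated, which `hlive` is allowed to use. -/
theorem advance (hx : IsExecution ec H w s ev) {X Y : Pc n} (hX : AllReach H s X)
    (hdone : ∀ v, X ≠ .done v)
    (hlive : ∀ i ∈ H, (∀ᶠ τ in atTop, (s τ i).terminated = false) →
      ∀ᶠ τ in atTop, (s τ i).pc = X → (apvaStep i (s τ i)).isSome)
    (hstep : ∀ i ∈ H, ∀ τ x, (s τ i).pc = X → apvaStep i (s τ i) = some x → x.pc = Y) :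
    AllReach H s Y := by
  intro i hi
  obtain ⟨τ, hτ⟩ := hX i hi
  obtain ⟨τ', -, h1, h2⟩ := hx.apva_progress hi hτ hdone fun hstay => by
    have hpc : ∀ᶠ τ' in atTop, (s τ' i).pc = X := eventually_atTop.2 ⟨τ, hstay⟩
    have ht : ∀ᶠ τ' in atTop, (s τ' i).terminated = false := by
      filter_upwards [hpc] with τ' h
      by_contra hne
      obtain ⟨-, v, hv⟩ := (hx.localInv hi τ').terminated (by simpa using hne)
      exact hdone v (h ▸ hv)
    filter_upwards [hlive i hi ht, hpc] with τ' h1 h2 using h1 h2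
  exact ⟨τ' + 1, hstep i hi τ' _ h1 h2⟩

/-- Since the values are binary, if no honest node had input `a`, all would have input `!a`, and
validity would force the output `!a`. -/
theorem agreeOut_common (hnt : 3 * t + 1 ≤ n) (hH : Hᶜ.ncard ≤ t) (hx : IsExecution ec H w s ev)
    {k : AgreeId n} (hin : ∀ i ∈ H, ∃ τ, ((s τ i).agreeIn k).isSome) :
    ∃ a, (∀ i ∈ H, ∀ᶠ τ in atTop, (s τ i).agreeOut k = some a) ∧
      (∀ i ∈ H, ∀ τ b, (s τ i).agreeOut k = some b → b = a) ∧
      ∃ i ∈ H, ∃ τ, (s τ i).agreeIn k = some a := by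
  obtain ⟨i₀, hi₀⟩ := exists_honest_node hnt hH
  obtain ⟨τ₀, h₀⟩ := (hx.agree k).termination hin i₀ hi₀
  obtain ⟨a, h₀⟩ := Option.isSome_iff_exists.1 h₀
  have hout : ∀ i ∈ H, ∀ᶠ τ in atTop, (s τ i).agreeOut k = some a := by
    intro i hi
    obtain ⟨τ, h⟩ := (hx.agree k).consistency i₀ hi₀ τ₀ a h₀ i hi
    exact hx.eventually_of_mono hi (P := fun x => x.agreeOut k = some a)
      (fun x y h => h.agreeOut k a) h
  have huniq : ∀ i ∈ H, ∀ τ b, (s τ i).agreeOut k = some b → b = a := by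
    intro i hi τ b h
    obtain ⟨τ', h1, h2⟩ := ((hout i hi).and (hx.eventually_of_mono hi
      (P := fun x => x.agreeOut k = some b) (fun x y h => h.agreeOut k b) h)).exists
    rw [h1] at h2
    exact (Option.some.inj h2).symm
  refine ⟨a, hout, huniq, ?_⟩
  by_contra! hcon
  obtain ⟨τ, h⟩ := (hx.agree k).validity (!a) (fun i hi => by
    obtain ⟨τ, h⟩ := hin i hi
    obtain ⟨b, h⟩ := Option.isSome_iff_exists.1 h
    refine ⟨τ, ?_⟩
    have := hcon i hi τ
    rw [h] at this
    rw [h]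
    cases a <;> cases b <;> simp_all) i₀ hi₀
  have := huniq i₀ hi₀ τ _ h
  cases a <;> simp at this

/-- Every branch depends on a value common to all honest nodes, so they move in step through the
control points; each branch that fails is incompatible with a good leader. -/
theorem round (hnt : 3 * t + 1 ≤ n) (hH : Hᶜ.ncard ≤ t) (hx : IsExecution ec H w s ev)
    {coin : Fin n → Fin n} (hcoin : Elects H s coin) (r : Fin n)
    (hr : AllReach H s (.electing r)) :
    (∃ v, AllReach H s (.done v) ∧
      ∃ l, ∃ i ∈ H, ∃ τ, (s τ i).vecOut l = some v ∧ (s τ i).agreeIn (.second l) = some true) ∨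
    (AllReach H s (nextPc r) ∧ ¬ GoodLeader H s (coin r)) := by
  obtain ⟨l, hl⟩ : ∃ l, l = coin r := ⟨_, rfl⟩
  rw [← hl]
  have inv := fun {i} (hi : i ∈ H) τ => hx.localInv hi τ
  have hact : ∀ i ∈ H, ∃ τ, r ∈ (s τ i).coinOn := fun i hi => by
    obtain ⟨τ, h⟩ := hr i hi
    have := (inv hi τ).pc
    rw [h] at this
    exact ⟨τ, this.2⟩
  have h1 : AllReach H s (.biased r l) := by
    refine hx.advance hr (by simp) ?_ ?_
    · intro i hi _
      obtain ⟨S, hS, hS'⟩ := exists_honest_finset hH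
      obtain ⟨τ, h⟩ := (hcoin r).termination ⟨S, fun p hp => (hS' p).1 hp, by omega,
        fun p hp => hact p ((hS' p).1 hp)⟩ i hi (hact i hi)
      filter_upwards [hx.eventually_of_mono hi (P := fun x => (x.coinOut r).isSome)
        (fun x y h => Option.isSome_mono (h.coinOut r)) h] with τ' h2 h3
      obtain ⟨c, h2⟩ := Option.isSome_iff_exists.1 h2
      simp [apvaStep, h3, h2]
    · intro i hi τ x hpc hstep
      unfold apvaStep at hstep
      simp only [hpc] at hstep
      split at hstep
      · simp at hstep
      · rename_i c hc
        simp only [Option.some.injEq] at hstep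
        have := (hcoin r).consistency i hi τ c hc
        rw [← hstep, this, hl]
  have hin1 : ∀ q ∈ H, ∃ τ, ((s τ q).biasedIn (.main l)).isSome := fun i hi => by
    obtain ⟨τ, h⟩ := h1 i hi
    have := (inv hi τ).pc
    rw [h] at this
    exact ⟨τ, this.2⟩
  have h2 : AllReach H s (.agree r l) := by
    refine hx.advance h1 (by simp) ?_ ?_
    · intro i hi ht
      obtain ⟨τ, h⟩ := hx.main_terminates hnt hH hi l ht hin1
      filter_upwards [hx.eventually_of_mono hi (P := fun x => (x.biasedOut (.main l)).isSome)
        (fun x y h => Option.isSome_mono (h.biasedOut _)) h] with τ' h2 h3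
      obtain ⟨c, h2⟩ := Option.isSome_iff_exists.1 h2
      simp [apvaStep, h3, h2]
    · intro i hi τ x hpc hstep
      unfold apvaStep at hstep
      simp only [hpc] at hstep
      split at hstep
      · simp at hstep
      · simp only [Option.some.injEq] at hstep
        rw [← hstep]
  have hin2 : ∀ q ∈ H, ∃ τ, ((s τ q).agreeIn (.first l)).isSome := fun i hi => by
    obtain ⟨τ, h⟩ := h2 i hi
    have := (inv hi τ).pc
    rw [h] at this
    exact ⟨τ, this.2⟩
  obtain ⟨a, hout, huniq, p, hp, τp, hinp⟩ := hx.agreeOut_common hnt hH hin2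
  have hinp := (inv hp τp).agreeIn_first l a hinp
  -- The common output is an input of the honest node `p`, so output `0` means that the biased
  -- agreement answered `0` at `p`, which a good leader excludes.
  cases a
  · refine Or.inr ⟨hx.advance h2 (by simp) ?_ ?_, fun hg =>
      hx.main_ne_false hnt hp hg hin1 τp hinp⟩
    · intro i hi _
      filter_upwards [hout i hi] with τ h3 h4
      simp [apvaStep, h3, h4]
    · intro i hi τ x hpc hstep
      unfold apvaStep at hstep
      simp only [hpc] at hstep
      split at hstep
      · simp at hstep
      · rename_i hc
        simpa using huniq i hi τ _ hc
      · simp only [Option.some.injEq] at hstep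
        rw [← hstep, NodeState.nextRound_pc]
  have h3 : AllReach H s (.waitVec r l) := by
    refine hx.advance h2 (by simp) ?_ ?_
    · intro i hi _
      filter_upwards [hout i hi] with τ h3 h4
      simp [apvaStep, h3, h4]
    · intro i hi τ x hpc hstep
      unfold apvaStep at hstep
      simp only [hpc] at hstep
      split at hstep
      · simp at hstep
      · simp only [Option.some.injEq] at hstep
        rw [← hstep]
      · rename_i hc
        simpa using huniq i hi τ _ hc
  obtain ⟨p', hp', τ', hv⟩ := hx.exists_vecOut_of_main_true hnt hH hp hinp
  obtain ⟨v, hv⟩ := Option.isSome_iff_exists.1 hv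
  have hvec : ∀ i ∈ H, ∀ᶠ τ in atTop, (s τ i).vecOut l = some v := by
    intro i hi
    obtain ⟨τ, h⟩ := (hx.rbcVec l).totality p' hp' τ' v hv i hi
    obtain ⟨v', h⟩ := Option.isSome_iff_exists.1 h
    have := hx.vecOut_unique hi hp' h hv
    subst this
    exact hx.eventually_of_mono hi (P := fun x => x.vecOut l = some v')
      (fun x y h => h.vecOut l v') h
  -- The vector `v` is common, so all take the same branch; an honest leader broadcasts exactly `n -
  -- t` entries.
  by_cases hcard : n - t ≤ (nonMissing v).card
  swap
  · refine Or.inr ⟨hx.advance h3 (by simp) ?_ ?_, fun hg =>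
      hcard (hx.vecOut_of_honest hp' hg.honest hv).1.ge⟩
    · intro i hi _
      filter_upwards [hvec i hi] with τ h3 h4
      simp [apvaStep, h3, h4, hcard]
    · intro i hi τ x hpc hstep
      unfold apvaStep at hstep
      simp only [hpc] at hstep
      split at hstep
      · simp at hstep
      · rename_i v' hv'
        have := hx.vecOut_unique hi hp' hv' hv
        subst this
        rw [if_neg hcard, Option.some.injEq] at hstep
        rw [← hstep, NodeState.nextRound_pc]
  have h4 : AllReach H s (.entries r l v) := by
    refine hx.advance h3 (by simp) ?_ ?_
    · intro i hi _
      filter_upwards [hvec i hi] with τ h3 h4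
      simp [apvaStep, h3, h4, hcard]
    · intro i hi τ x hpc hstep
      unfold apvaStep at hstep
      simp only [hpc] at hstep
      split at hstep
      · simp at hstep
      · rename_i v' hv'
        have := hx.vecOut_unique hi hp' hv' hv
        subst this
        rw [if_pos hcard, Option.some.injEq] at hstep
        rw [← hstep]
  have hin3 : ∀ j ∈ nonMissing v, ∀ q ∈ H, ∃ τ, ((s τ q).biasedIn (.entry l j)).isSome :=
    fun j hj i hi => by
      obtain ⟨τ, h⟩ := h4 i hi
      have := (inv hi τ).pc
      rw [h] at this
      exact ⟨τ, this.2.2.2 j hj⟩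
  have h5 : AllReach H s (.agreeVec r l v) := by
    refine hx.advance h4 (by simp) ?_ ?_
    · intro i hi ht
      have : ∀ᶠ τ in atTop, ∀ j ∈ nonMissing v, ((s τ i).biasedOut (.entry l j)).isSome := by
        rw [eventually_all_finset]
        intro j hj
        obtain ⟨τ, h⟩ := hx.entry_terminates hnt hH hi hp' hv hj ht (hin3 j hj)
        exact hx.eventually_of_mono hi (P := fun x => (x.biasedOut (.entry l j)).isSome)
          (fun x y h => Option.isSome_mono (h.biasedOut _)) h
      filter_upwards [this] with τ h5 h6
      simp only [apvaStep, h6]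
      rw [if_pos h5]
      rfl
    · intro i hi τ x hpc hstep
      unfold apvaStep at hstep
      simp only [hpc] at hstep
      split_ifs at hstep
      simp only [Option.some.injEq] at hstep
      rw [← hstep]
  have hin4 : ∀ q ∈ H, ∃ τ, ((s τ q).agreeIn (.second l)).isSome := fun i hi => by
    obtain ⟨τ, h⟩ := h5 i hi
    have := (inv hi τ).pc
    rw [h] at this
    exact ⟨τ, this.2.2⟩
  obtain ⟨a, hout, huniq, q, hq, τq, hinq⟩ := hx.agreeOut_common hnt hH hin4
  obtain ⟨v', hv', hsome, hall⟩ := (inv hq τq).agreeIn_second l a hinq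
  have := hx.vecOut_unique hq hp' hv' hv
  subst this
  cases a
  · refine Or.inr ⟨hx.advance h5 (by simp) ?_ ?_, fun hg => ?_⟩
    · intro i hi _
      filter_upwards [hout i hi] with τ h3 h4
      simp [apvaStep, h3, h4]
    · intro i hi τ x hpc hstep
      unfold apvaStep at hstep
      simp only [hpc] at hstep
      split at hstep
      · simp at hstep
      · rename_i hc
        simpa using huniq i hi τ _ hc
      · simp only [Option.some.injEq] at hstep
        rw [← hstep, NodeState.nextRound_pc]
    -- Input `0` at `q` comes from an entry answered `0`, impossible for an honest leader.
    · simp only [Bool.false_eq_true, false_iff, not_forall] at hall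
      obtain ⟨j, hj, h⟩ := hall
      obtain ⟨c, hc⟩ := Option.isSome_iff_exists.1 (hsome j hj)
      cases c
      · exact hx.entry_ne_false hnt hH hq hp' hg.honest hv hj (hin3 j hj) τq hc
      · exact h hc
  · refine Or.inl ⟨v', hx.advance h5 (by simp) ?_ ?_, l, q, hq, τq, hv', hinq⟩
    · intro i hi _
      filter_upwards [hout i hi] with τ h3 h4
      simp [apvaStep, h3, h4]
    · intro i hi τ x hpc hstep
      unfold apvaStep at hstep
      simp only [hpc] at hstep
      split at hstep
      · simp at hstep
      · simp only [Option.some.injEq] at hstep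
        rw [← hstep]
      · rename_i hc
        simpa using huniq i hi τ _ hc

theorem exists_done (hnt : 3 * t + 1 ≤ n) (hH : Hᶜ.ncard ≤ t) (hx : IsExecution ec H w s ev)
    {coin : Fin n → Fin n} (hcoin : Elects H s coin)
    (hdistinct : 2 * t + 1 ≤ (Finset.univ.image coin).card) :
    ∃ v, AllReach H s (.done v) ∧
      ∃ l, ∃ i ∈ H, ∃ τ, (s τ i).vecOut l = some v ∧
        (s τ i).agreeIn (.second l) = some true := by
  by_contra hcon
  have hrounds : ∀ k (hk : k < n), AllReach H s (.electing ⟨k, hk⟩) := by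
    intro k
    induction k with
    | zero =>
      intro hk
      refine hx.advance (X := .idle) (fun i hi => ⟨0, by rw [hx.init i hi]; rfl⟩) (by simp) ?_ ?_
      · intro i hi _
        obtain ⟨τ, h⟩ := hx.exists_returned hnt hH hi
        filter_upwards [hx.eventually_of_mono hi (P := fun x => x.returned = true)
          (fun x y h => h.returned) h] with τ' h1 h2
        simp [apvaStep, h1, h2]
      · intro i hi τ x hpc hstep
        unfold apvaStep at hstep
        simp only [hpc] at hstep
        split_ifs at hstep
        simp only [Option.some.injEq] at hstep
        rw [← hstep]
        rfl
    | succ k ih =>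
      intro hk
      rcases hx.round hnt hH hcoin ⟨k, by omega⟩ (ih (by omega)) with h | ⟨h, -⟩
      · exact absurd h hcon
      · rwa [nextPc, dif_pos hk] at h
  obtain ⟨S, hS, hgood⟩ := hx.exists_goodLeaders hnt hH
  -- Disjoint sets of sizes `n - 2t` and `2t + 1` do not fit into `n` nodes.
  obtain ⟨l, hl, hl'⟩ : ∃ l ∈ S, l ∈ Finset.univ.image coin := by
    by_contra! h
    have h1 := Finset.card_le_univ (S ∪ Finset.univ.image coin)
    rw [Finset.card_union_of_disjoint (Finset.disjoint_left.2 h), Fintype.card_fin] at h1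
    omega
  simp only [Finset.mem_image, Finset.mem_univ, true_and] at hl'
  obtain ⟨r, rfl⟩ := hl'
  rcases hx.round hnt hH hcoin r (hrounds r.1 r.2) with h | ⟨-, h⟩
  · exact hcon h
  · exact h (hgood _ hl)

/-! ### From the common vector to the output -/

/-- The input `1` at `p` certifies answers `1` for all non-missing entries. Each goes back to an
honest vote, whose sender had received the symbol; totality delivers it to `i`. -/
theorem terminates_of_done (hnt : 3 * t + 1 ≤ n) (hH : Hᶜ.ncard ≤ t)
    (hx : IsExecution ec H w s ev) {v : PVec n} (hdone : AllReach H s (.done v))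
    {l p : Fin n} (hp : p ∈ H) {τp : ℕ} (hv : (s τp p).vecOut l = some v)
    (hin : (s τp p).agreeIn (.second l) = some true) {i : Fin n} (hi : i ∈ H) :
    ∃ τ, (s τ i).terminated = true := by
  obtain ⟨τ, hτ⟩ := hdone i hi
  have hpc : ∀ᶠ τ' in atTop, (s τ' i).pc = .done v := by
    refine eventually_atTop.2 ⟨τ, fun τ' h => ?_⟩
    induction τ', h using Nat.le_induction with
    | base => exact hτ
    | succ k _ ih =>
      by_contra hne
      rcases hx.step_cases hi k with h | ⟨e, -, he⟩
      · rw [h] at hne; exact hne ih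
      · have := pc_apply ec i (w i) e he (by rw [ih]; exact hne)
        subst this
        simp [Event.apply, fire, apvaStep, ih] at he
  obtain ⟨v', hv', -, hall⟩ := (hx.localInv hp τp).agreeIn_second l true hin
  rw [hv, Option.some.injEq] at hv'
  subst hv'
  have hsym : ∀ᶠ τ' in atTop, ∀ j ∈ nonMissing v, ((s τ' i).symOut j).isSome := by
    rw [eventually_all_finset]
    intro j hj
    obtain ⟨q, hq, τq, h⟩ := hx.exists_symOut_of_entry_true hnt hH hp (hall.1 rfl j hj)
    obtain ⟨y, h⟩ := Option.isSome_iff_exists.1 h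
    obtain ⟨τ₁, h⟩ := (hx.rbcSym j).totality q hq τq y h i hi
    exact hx.eventually_of_mono hi (P := fun x => (x.symOut j).isSome)
      (fun x y h => Option.isSome_mono (h.symOut j)) h
  refine hx.reach hi .decide (P := fun x => x.terminated = true) ?_
  filter_upwards [hpc, hsym] with τ' h1 h2
  by_cases ht : (s τ' i).terminated = true
  · exact Or.inl ht
  right
  simp only [fire, if_neg ht, decideStep, h1]
  split_ifs with h3 h4
  · exact ⟨_, rfl, rfl⟩
  · exact ⟨_, rfl, rfl⟩
  -- The symbols awaited sit at positions where `v` is `1`, which are non-missing.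
  · refine absurd (fun j hj => h2 j ?_) h4
    simp only [smallest, Finset.mem_filter, Finset.mem_univ, true_and] at hj
    simp [nonMissing, hj.1]

end IsExecution

end OciorABA

open OciorABA in
theorem mainTheorem3 {n t : ℕ} (hnt : 3 * t + 1 ≤ n) {A : Type*} (ec : ErasureCode n (t + 1) A)
    (dishonest : Finset (Fin n)) (hdishonest : dishonest.card ≤ t)
    (w : Fin n → Fin (t + 1) → A)
    (s : ℕ → Fin n → NodeState n t A) (ev : ℕ → Option (Fin n × Event n A))
    (hexec : IsExecution ec {i | i ∉ dishonest} w s ev)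
    (coin : Fin n → Fin n) (hcoin : Elects {i | i ∉ dishonest} s coin)
    (hdistinct : 2 * t + 1 ≤ (Finset.univ.image coin).card) :
    ∀ i, i ∉ dishonest → ∃ (τ : ℕ) (v : Option (Fin (t + 1) → A)),
      ∀ τ', τ ≤ τ' → (s τ' i).output = some v ∧ (s τ' i).terminated = true := by
  have hH : ({i | i ∉ dishonest}ᶜ : Set (Fin n)).ncard ≤ t := by
    have : ({i | i ∉ dishonest}ᶜ : Set (Fin n)) = ↑dishonest := by ext; simp
    rw [this, Set.ncard_coe_finset]
    exact hdishonest
  intro i hi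
  obtain ⟨v, hdone, l, p, hp, τp, hv, hin⟩ := hexec.exists_done hnt hH hcoin hdistinct
  obtain ⟨τ, hτ⟩ := hexec.terminates_of_done hnt hH hdone hp hv hin (i := i) hi
  obtain ⟨o, ho⟩ := Option.isSome_iff_exists.1 ((hexec.localInv (i := i) hi τ).terminated hτ).1
  refine ⟨τ, o, fun τ' hle => ?_⟩
  -- Monotonicity keeps a terminated node terminated and its output fixed, so the conclusion holds
  -- at all later times.
  obtain ⟨h1, h2⟩ := (hexec.mono (i := i) hi hle).terminated hτ
  exact ⟨h2.trans ho, h1⟩
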